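/- For integers $n\ge 0$, $d \ge 1$, let $S_n$ be the group of permutations of $[n]=\{1,\dots,n\}$. For $\sigma\in S_n$ put $$\mathrm{exc}(\sigma)=|\{i\in[n]:\sigma(i)>i\}|,\qquad \mathrm{fix}(\sigma)=|\{i\in[n]:\sigma(i)=i\}|,\qquad \mathrm{maj}(\sigma)=\sum_{1\le i\le n-1,\ \sigma(i)>\sigma(i+1)} i .$$ Put $$A_n^{\mathrm{maj},\mathrm{exc},\mathrm{fix}}(q,t,r)=\sum_{\sigma\in S_n}q^{\mathrm{maj}(\sigma)}t^{\mathrm{exc}(\sigma)}r^{\mathrm{fix}(\sigma)},\qquad A_n^{\mathrm{exc},\mathrm{fix}}(t,r)=\sum_{\sigma\in S_n}t^{\mathrm{exc}(\sigma)}r^{\mathrm{fix}(\sigma)}$$ (both equal $1$ for $n=0$), and $[m]_t=\sum_{j=0}^{m-1}t^j$ for $m\ge 0$. Let $\gamma_n=(1,2,\dots,n)\in S_n$ be the $n$-cycle $1\mapsto 2\mapsto\cdots\mapsto n\mapsto 1$ (the identity if $n=0$), and let $C_{S_n}(\tau)$ denote the centralizer of $\tau$ in $S_n$. **Theorem.**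 Let $d\ge1$ and $k\ge0$ be integers, let $n=dk$, and let $\omega_d\in\mathbb{C}$ be any primitive $d$-th root of unity. Let $t,s$ be indeterminates. Then the following three expressions are equal: (i) and (ii) as polynomials in $\mathbb{C}[t,s]$, and both are equal to (iii) in the field of rational functions $\mathbb{C}(t,s)$. - (i) $A_n^{\mathrm{maj},\mathrm{exc},\mathrm{fix}}(\omega_d,\,t\,\omega_d^{-1},\,s)$; - (ii) $\displaystyle\sum_{\sigma\in C_{S_n}(\gamma_n^k)}t^{\mathrm{exc}(\sigma)}s^{\mathrm{fix}(\sigma)}$; - (iii) $\displaystyle A_k^{\mathrm{exc},\mathrm{fix}}\!\left(t,\ \frac{s^d+t[d-1]_t}{[d]_t}\right)[d]_t^{\,k}$. -/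

import Mathlib

namespace EulerianCyclic

/-- The excedance set of a permutation: all `i` with `σ i > i` (the last position never
qualifies). -/
def excSet {n : ℕ} (σ : Equiv.Perm (Fin n)) : Finset (Fin n) :=
  Finset.univ.filter fun i => i < σ i

/-- The excedance number. -/
def exc {n : ℕ} (σ : Equiv.Perm (Fin n)) : ℕ := (excSet σ).card

/-- The descent set, as a set of positions counted from `0`: all `i` such that `i + 1` is also a
position and `σ i > σ (i + 1)`. -/
def desSet {n : ℕ} (σ : Equiv.Perm (Fin n)) : Finset (Fin n) :=
  Finset.univ.filter fun i => ∃ h : (i : ℕ) + 1 < n, σ ⟨(i : ℕ) + 1, h⟩ < σ i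

/-- The major index: the sum of the descents, where positions are counted from `1`, so that
`i : Fin n` stands for the position `i + 1`. -/
def maj {n : ℕ} (σ : Equiv.Perm (Fin n)) : ℕ := ∑ i ∈ desSet σ, ((i : ℕ) + 1)

/-- The number of fixed points. -/
def fix {n : ℕ} (σ : Equiv.Perm (Fin n)) : ℕ :=
  (Finset.univ.filter fun i => σ i = i).card

/-- `A_n^{maj,exc,fix}(q,t,r)`, the sum of `q^maj(σ) t^exc(σ) r^fix(σ)` over all `σ` in `S_n`. -/
def majExcFixPoly {R : Type*} [CommSemiring R] (n : ℕ) (q t r : R) : R :=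
  ∑ σ : Equiv.Perm (Fin n), q ^ maj σ * t ^ exc σ * r ^ fix σ

/-- `A_n^{exc,fix}(t,r)`, the sum of `t^exc(σ) r^fix(σ)` over all `σ` in `S_n`. -/
def excFixPoly {R : Type*} [CommSemiring R] (n : ℕ) (t r : R) : R :=
  ∑ σ : Equiv.Perm (Fin n), t ^ exc σ * r ^ fix σ

open Classical in
/-- The sum of `t^exc(σ) r^fix(σ)` over the centralizer of `τ` in `S_n`. -/
noncomputable def centralizerExcFixPoly {R : Type*} [CommSemiring R] {n : ℕ}
    (τ : Equiv.Perm (Fin n)) (t r : R) : R :=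
  ∑ σ ∈ Finset.univ.filter
    (fun σ : Equiv.Perm (Fin n) => σ ∈ Subgroup.centralizer ({τ} : Set (Equiv.Perm (Fin n)))),
    t ^ exc σ * r ^ fix σ

/-- The `q`-analogue `[n]_q = 1 + q + ⋯ + q^(n-1)`. -/
def qNum {R : Type*} [CommSemiring R] (n : ℕ) (q : R) : R := ∑ j ∈ Finset.range n, q ^ j

/-- The polynomial ring `ℂ[t,s]`. -/
abbrev PolyTS : Type := MvPolynomial (Fin 2) ℂ

/-- The indeterminate `t`. -/
noncomputable def tVar : PolyTS := MvPolynomial.X 0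

/-- The indeterminate `s`. -/
noncomputable def sVar : PolyTS := MvPolynomial.X 1

/-- The field of rational functions `ℂ(t,s)`. -/
abbrev RatTS : Type := FractionRing PolyTS

/-- The indeterminate `t` as a rational function. -/
noncomputable def tRat : RatTS := algebraMap PolyTS RatTS tVar

/-- The indeterminate `s` as a rational function. -/
noncomputable def sRat : RatTS := algebraMap PolyTS RatTS sVar

end EulerianCyclic

/-!
Write `B_n(q,t,r) = ∑ q^(maj - exc) t^exc r^fix`, the sum over `S_n`; this is `dexPoly`.
The polynomial `majExcFixPoly` at `(ω, t/ω, s)` is `B_{dk}(ω,t,s)`. Everything rests on the recurrence (`sum_gaussBinom_mul_dexPoly`)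
`∑_{i+j=n} [n,i]_q (t^i - t) B_j = (1 - t) r^n`,
which is the Shareshian-Wachs formula `(1 - t) e_q(rz) / (e_q(tz) - t e_q(z))` for the
`q`-exponential generating function of `B_n`.

*The recurrence.* `maj - exc` is the sum of the descents of `σ` when all values at excedances are
declared smaller than all other values (`maj_eq_dexSum_add_exc`). Hence, by the usual expansion of
a descent generating function, `B_n / ((1 - q)⋯(1 - qⁿ))` enumerates pairs of a `σ` and a weakly
decreasing word `s` that decreases strictly at these descents. For fixed `s`, cut the positions
into the blocks on which `s` is constant. Recording, at each value, the block it comes from and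
whether it is an excedance value turns the `σ` compatible with `s` into words, one for each block,
subject only to conditions within the single blocks and to having the same content as `s`; sorting
recovers `σ` (`sum_compat_eq_sum_fills`). So the weighted number `N(m)` of these `σ`, where `m` is
the content of `s`, is the coefficient of `X^m` in a product `∏ c, U_c` with one factor for each
block (`sum_compat_eq_coeff`).

Multiplying the series of the `N(m)` by `H(t)` or by `H(1)`, where `H(u) = ∏ 1 / (1 - u X_c)`,
turns the factors into `(r X_c)^(m_c) + (L_c - X_c) K_c` and `(r X_c)^(m_c) + (L_c - t X_c) K_c`,
where `L_c = ∑_{b ≥ c} X_b + t ∑_{b ≤ c} X_b`. Since `L_c - X_c` equals `L_{c'} - t X_{c'}` for the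
next letter `c'`, the products of the `L_c - X_c` and of the `L_c - t X_c` over any nonempty set of
letters differ exactly by the factor `t` once the other variables are set to zero
(`prod_sub_eq_mul_prod_sub`). Therefore `(H(t) - t H(1)) N = (1 - t) H(r)`
(`sum_antidiagonal_coeff_prod_blockPoly`), and putting `X_c = q^c` gives the recurrence. To stay
with finite sums, this is done for the letters `0, …, l - 1` and modulo `q^l`, for every `l`.

*Roots of unity.* At `q = ω` the `q`-Lucas theorem (`gaussBinom_mul_primitiveRoot`) leaves a binomial
recurrence for `B_{dk}`, and `q = 1` gives one for `A_k^{exc,fix}`. Comparing exponential generating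
functions expresses the former by the latter (`dexPoly_primitiveRoot`).

*The centralizer.* With positions written as `a + k j`, the power `γ_n^k` shifts `j`, and its
centralizer is the wreath product of `ℤ/d` by `S_k`. The weight is a product over the columns `a`,
and summing over the shift of each column gives the same expression in `A_k^{exc,fix}`
(`centralizerExcFixPoly_eq_excFixPoly`).
-/

namespace EulerianCyclic

open Finset

/-! ### Gaussian binomial coefficients -/

/-- The Gaussian binomial coefficient, by the recursion
`[n+1, k+1] = [n, k] + q^(k+1) [n, k+1]`; it makes sense for every `q` in a commutative ring. -/
def gaussBinom {R : Type*} [CommRing R] (q : R) : ℕ → ℕ → R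
  | _, 0 => 1
  | 0, _ + 1 => 0
  | n + 1, k + 1 => gaussBinom q n k + q ^ (k + 1) * gaussBinom q n (k + 1)

/-- The `q`-Pochhammer symbol `(1 - q)(1 - q²)⋯(1 - qⁿ)`. -/
def qPoch {R : Type*} [CommRing R] (q : R) (n : ℕ) : R := ∏ i ∈ range n, (1 - q ^ (i + 1))

section Gauss

variable {R : Type*} [CommRing R] (q : R)

@[simp] theorem gaussBinom_zero_right (n : ℕ) : gaussBinom q n 0 = 1 := by
  cases n <;> rfl

theorem gaussBinom_succ_succ (n k : ℕ) :
    gaussBinom q (n + 1) (k + 1) = gaussBinom q n k + q ^ (k + 1) * gaussBinom q n (k + 1) := rfl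

theorem gaussBinom_eq_zero_of_lt {n k : ℕ} (h : n < k) : gaussBinom q n k = 0 := by
  induction n generalizing k with
  | zero => obtain ⟨k, rfl⟩ := Nat.exists_eq_succ_of_ne_zero h.ne'; rfl
  | succ n ih =>
    obtain ⟨k, rfl⟩ := Nat.exists_eq_succ_of_ne_zero (Nat.ne_zero_of_lt h)
    rw [Nat.succ_eq_add_one, gaussBinom_succ_succ, ih (by omega), ih (by omega)]
    simp

theorem gaussBinom_self (n : ℕ) : gaussBinom q n n = 1 := by
  induction n with
  | zero => rfl
  | succ n ih => rw [gaussBinom_succ_succ, ih, gaussBinom_eq_zero_of_lt q (Nat.lt_succ_self n)]; simp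

theorem qPoch_succ (n : ℕ) : qPoch q (n + 1) = qPoch q n * (1 - q ^ (n + 1)) :=
  prod_range_succ _ _

theorem gaussBinom_add_mul (i j : ℕ) :
    gaussBinom q (i + j) i * (qPoch q i * qPoch q j) = qPoch q (i + j) := by
  induction i generalizing j with
  | zero => simp [qPoch]
  | succ i ihi =>
    induction j with
    | zero => simp [gaussBinom_self, qPoch]
    | succ j ihj =>
      have e : i + 1 + (j + 1) = (i + j + 1) + 1 := by ring
      have h1 := ihi (j + 1)
      have e1 : i + (j + 1) = i + j + 1 := by ring
      have e2 : i + 1 + j = i + j + 1 := by ring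
      rw [e1] at h1
      rw [e2] at ihj
      rw [e, gaussBinom_succ_succ, qPoch_succ q (i + j + 1)]
      have : (gaussBinom q (i + j + 1) i + q ^ (i + 1) * gaussBinom q (i + j + 1) (i + 1)) *
          (qPoch q (i + 1) * qPoch q (j + 1)) =
          (1 - q ^ (i + 1)) * (gaussBinom q (i + j + 1) i * (qPoch q i * qPoch q (j + 1))) +
          q ^ (i + 1) * (1 - q ^ (j + 1)) *
            (gaussBinom q (i + j + 1) (i + 1) * (qPoch q (i + 1) * qPoch q j)) := by
        rw [qPoch_succ q i, qPoch_succ q j]; ring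
      rw [this, h1, ihj]
      ring

theorem map_gaussBinom {S : Type*} [CommRing S] (f : R →+* S) (n k : ℕ) :
    f (gaussBinom q n k) = gaussBinom (f q) n k := by
  induction n generalizing k with
  | zero => cases k <;> simp [gaussBinom]
  | succ n ih => cases k <;> simp [gaussBinom_succ_succ, ih]

theorem gaussBinom_one (n k : ℕ) : gaussBinom (1 : R) n k = n.choose k := by
  induction n generalizing k with
  | zero => cases k <;> simp [gaussBinom]
  | succ n ih => cases k <;> simp [gaussBinom_succ_succ, ih, Nat.choose_succ_succ]

variable [IsDomain R] {q} {d : ℕ}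

theorem gaussBinom_primitiveRoot_eq_zero (hq : IsPrimitiveRoot q d) {j : ℕ} (h0 : 0 < j)
    (hj : j < d) : gaussBinom q d j = 0 := by
  have hne : ∀ m < d, qPoch q m ≠ 0 := fun m hm =>
    prod_ne_zero_iff.2 fun i hi => sub_ne_zero.2
      (hq.pow_ne_one_of_pos_of_lt i.succ_ne_zero (by rw [mem_range] at hi; omega)).symm
  have h := gaussBinom_add_mul q j (d - j)
  rw [Nat.add_sub_cancel' hj.le] at h
  have hd : qPoch q d = 0 := by
    obtain ⟨e, rfl⟩ := Nat.exists_eq_succ_of_ne_zero (Nat.ne_zero_of_lt hj)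
    rw [Nat.succ_eq_add_one, qPoch_succ, hq.pow_eq_one, sub_self, mul_zero]
  rw [hd] at h
  exact (mul_eq_zero.1 h).resolve_right (mul_ne_zero (hne _ hj) (hne _ (by omega)))

theorem gaussBinom_add_primitiveRoot (hq : IsPrimitiveRoot q d) (hd : 0 < d) (m k : ℕ) :
    gaussBinom q (m + d) k = gaussBinom q m k + if d ≤ k then gaussBinom q m (k - d) else 0 := by
  induction m generalizing k with
  | zero =>
    rw [zero_add]
    rcases Nat.eq_zero_or_pos k with rfl | hk
    · simp [hd.ne']
    rw [gaussBinom_eq_zero_of_lt q hk, zero_add]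
    rcases lt_trichotomy k d with h | h | h
    · rw [gaussBinom_primitiveRoot_eq_zero hq hk h, if_neg (by omega)]
    · simp [h, gaussBinom_self]
    · rw [gaussBinom_eq_zero_of_lt q h, if_pos h.le, gaussBinom_eq_zero_of_lt q (by omega)]
  | succ m ih =>
    rcases k with _ | k
    · simp [hd.ne']
    rw [show m + 1 + d = (m + d) + 1 by ring, gaussBinom_succ_succ, gaussBinom_succ_succ, ih, ih]
    rcases lt_trichotomy (k + 1) d with h | h | h
    · rw [if_neg (by omega), if_neg (by omega), if_neg (by omega)]; ring
    · rw [if_neg (by omega), if_pos h.ge, if_pos h.ge, h, hq.pow_eq_one]; simp [add_assoc]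
    · obtain ⟨e, rfl⟩ := Nat.exists_eq_add_of_le (Nat.le_of_lt_succ h)
      rw [if_pos (by omega), if_pos (by omega), if_pos (by omega), show d + e + 1 - d = e + 1 by omega,
        show d + e - d = e by omega, gaussBinom_succ_succ, add_assoc d, pow_add, hq.pow_eq_one]
      ring

/-- At a primitive `d`-th root of unity, the Gaussian binomial `[dk, j]` is `k.choose (j / d)` if
`d ∣ j` and vanishes otherwise (the `q`-Lucas theorem). -/
theorem gaussBinom_mul_primitiveRoot (hq : IsPrimitiveRoot q d) (hd : 0 < d) (k j : ℕ) :
    gaussBinom q (d * k) j = if d ∣ j then (k.choose (j / d) : R) else 0 := by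
  induction k generalizing j with
  | zero =>
    rcases Nat.eq_zero_or_pos j with rfl | hj
    · simp
    rw [mul_zero, gaussBinom_eq_zero_of_lt q hj]
    split_ifs with h
    · obtain ⟨i, rfl⟩ := h
      rw [Nat.mul_div_cancel_left _ hd, Nat.choose_eq_zero_of_lt (Nat.pos_of_mul_pos_left hj)]
      simp
    · rfl
  | succ k ih =>
    rw [mul_add, mul_one, gaussBinom_add_primitiveRoot hq hd, ih]
    by_cases h : d ≤ j
    · obtain ⟨e, rfl⟩ := Nat.exists_eq_add_of_le h
      rw [if_pos h, show d + e - d = e by omega, ih,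
        Nat.add_div_left _ hd]
      simp only [Nat.dvd_add_right (dvd_refl d)]
      split_ifs
      · rw [Nat.choose_succ_succ]; push_cast; ring
      · simp
    · rw [if_neg h, add_zero]
      split_ifs with h2
      · obtain rfl := Nat.eq_zero_of_dvd_of_lt h2 (by omega)
        simp
      · rfl

end Gauss

/-! ### A telescoping product -/

section Telescope

variable {ι R : Type*} [LinearOrder ι] [CommRing R]

/-- The form of `prod_sub_eq_mul_prod_sub` that admits an induction on the largest element of `S`:
adding that element to `S` adds its value to `A` in all other factors. -/
theorem prod_shifted_sum (t : R) (x : ι → R) (S : Finset ι) (A : R) :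
    (∏ c ∈ S, (A + ∑ b ∈ S with c < b, x b + t * ∑ b ∈ S with b ≤ c, x b)) * (A + ∑ b ∈ S, x b) =
    (∏ c ∈ S, (A + ∑ b ∈ S with c ≤ b, x b + t * ∑ b ∈ S with b < c, x b)) *
      (A + t * ∑ b ∈ S, x b) := by
  induction S using Finset.induction_on_max generalizing A with
  | empty => simp
  | insert u S hu ih =>
    have hnot : u ∉ S := fun h => lt_irrefl _ (hu u h)
    rw [prod_insert hnot, prod_insert hnot, sum_insert hnot]
    have e1 : ∑ b ∈ insert u S with u < b, x b = 0 := by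
      rw [filter_eq_empty_iff.2, sum_empty]
      intro b hb
      rcases mem_insert.1 hb with rfl | hb
      · exact lt_irrefl _
      · exact (hu b hb).not_gt
    have e2 : ∑ b ∈ insert u S with b ≤ u, x b = x u + ∑ b ∈ S, x b := by
      rw [filter_true_of_mem, sum_insert hnot]
      intro b hb
      rcases mem_insert.1 hb with rfl | hb
      · exact le_rfl
      · exact (hu b hb).le
    have e3 : ∑ b ∈ insert u S with u ≤ b, x b = x u := by
      rw [filter_insert, if_pos le_rfl, filter_false_of_mem]
      · simp
      · exact fun b hb => (hu b hb).not_ge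
    have e4 : ∑ b ∈ insert u S with b < u, x b = ∑ b ∈ S, x b := by
      rw [filter_insert, if_neg (lt_irrefl _), filter_true_of_mem]
      exact hu
    have e5 : ∀ c ∈ S, A + ∑ b ∈ insert u S with c < b, x b + t * ∑ b ∈ insert u S with b ≤ c, x b
        = (A + x u) + ∑ b ∈ S with c < b, x b + t * ∑ b ∈ S with b ≤ c, x b := by
      intro c hc
      rw [filter_insert, if_pos (hu c hc), filter_insert, if_neg (hu c hc).not_ge,
        sum_insert (by simp [hnot])]
      ring
    have e6 : ∀ c ∈ S, A + ∑ b ∈ insert u S with c ≤ b, x b + t * ∑ b ∈ insert u S with b < c, x b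
        = (A + x u) + ∑ b ∈ S with c ≤ b, x b + t * ∑ b ∈ S with b < c, x b := by
      intro c hc
      rw [filter_insert, if_pos (hu c hc).le, filter_insert, if_neg (hu c hc).not_gt,
        sum_insert (by simp [hnot])]
      ring
    rw [prod_congr rfl e5, prod_congr rfl e6, e1, e2, e3, e4]
    have := ih (A + x u)
    linear_combination (A + t * (x u + ∑ b ∈ S, x b)) * this

/-- With `L c = ∑_{b ≥ c} x b + t ∑_{b ≤ c} x b`, one has `∏ (L c - x c) = t ∏ (L c - t x c)`:
both products run over the partial sums `∑_{b ≥ c} x b + t ∑_{b < c} x b`, except that the first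
omits the initial one, `∑ x b`, and contains the final one, `t ∑ x b`. -/
theorem prod_sub_eq_mul_prod_sub [IsDomain R] (t : R) (x : ι → R) (S : Finset ι)
    (hS : ∑ b ∈ S, x b ≠ 0) :
    ∏ c ∈ S, (∑ b ∈ S with c ≤ b, x b + t * ∑ b ∈ S with b ≤ c, x b - x c) =
    t * ∏ c ∈ S, (∑ b ∈ S with c ≤ b, x b + t * ∑ b ∈ S with b ≤ c, x b - t * x c) := by
  have h := prod_shifted_sum t x S 0
  simp only [zero_add] at h
  have e1 : ∀ c ∈ S, ∑ b ∈ S with c ≤ b, x b + t * ∑ b ∈ S with b ≤ c, x b - x c =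
      ∑ b ∈ S with c < b, x b + t * ∑ b ∈ S with b ≤ c, x b := by
    intro c hc
    have : S.filter (c ≤ ·) = insert c (S.filter (c < ·)) := by
      ext b; simp only [mem_filter, mem_insert, le_iff_eq_or_lt]
      constructor
      · rintro ⟨h, rfl | h'⟩ <;> simp_all
      · rintro (rfl | h) <;> simp_all
    rw [this, sum_insert (by simp)]; ring
  have e2 : ∀ c ∈ S, ∑ b ∈ S with c ≤ b, x b + t * ∑ b ∈ S with b ≤ c, x b - t * x c =
      ∑ b ∈ S with c ≤ b, x b + t * ∑ b ∈ S with b < c, x b := by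
    intro c hc
    have : S.filter (· ≤ c) = insert c (S.filter (· < c)) := by
      ext b; simp only [mem_filter, mem_insert, le_iff_eq_or_lt]
      constructor
      · rintro ⟨h, rfl | h'⟩ <;> simp_all
      · rintro (rfl | h) <;> simp_all
    rw [this, sum_insert (by simp)]; ring
  rw [prod_congr rfl e1, prod_congr rfl e2]
  refine mul_right_cancel₀ hS ?_
  linear_combination h

end Telescope

/-! ### Coefficients of the block polynomials -/

section Coeff

open MvPolynomial

variable {ι R : Type*} [LinearOrder ι] [Fintype ι] [CommRing R]

/-- The total weight of the letters allowed in the block `c`: a letter `b > c` has weight `X b`, a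
letter `b < c` has weight `t X b`, and the letter `c` comes in two forms, of weights `X c` and
`t X c`. -/
noncomputable def rowSum (t : R) (c : ι) : MvPolynomial ι R :=
  ∑ b with c ≤ b, X b + C t * ∑ b with b ≤ c, X b

/-- The complete homogeneous polynomial of degree `m - 1` in `r X c` and `rowSum t c` (zero for
`m = 0`). -/
noncomputable def rowHom (t r : R) (c : ι) : ℕ → MvPolynomial ι R
  | 0 => 0
  | m + 1 => (C r * X c) ^ m + rowSum t c * rowHom t r c m

/-- The generating polynomial of the words of length `m` in the letters allowed in the block `c`,
where `r` marks the letters of the longest final run of unmarked letters `c`. -/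
noncomputable def wordPoly (t r : R) (c : ι) : ℕ → MvPolynomial ι R
  | 0 => 1
  | m + 1 => rowSum t c * wordPoly t r c m + (C r * X c) ^ (m + 1) - X c * (C r * X c) ^ m

/-- The generating polynomial of the words counted by `wordPoly` that do not begin with the marked
letter `c`. -/
noncomputable def blockPoly (t r : R) (c : ι) : ℕ → MvPolynomial ι R
  | 0 => 1
  | m + 1 => wordPoly t r c (m + 1) - C t * X c * wordPoly t r c m

theorem wordPoly_eq (t r : R) (c : ι) (m : ℕ) :
    wordPoly t r c m = (C r * X c) ^ m + (rowSum t c - X c) * rowHom t r c m := by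
  induction m with
  | zero => simp [wordPoly, rowHom]
  | succ m ih => rw [wordPoly, ih, rowHom]; ring

/-- Allowing powers of `t X c` in front of a filling of a block cancels the condition on its first
letter. -/
theorem sum_antidiagonal_mul_blockPoly (t r : R) (c : ι) (m : ℕ) :
    ∑ p ∈ antidiagonal m, (C t * X c) ^ p.1 * blockPoly t r c p.2 =
      (C r * X c) ^ m + (rowSum t c - X c) * rowHom t r c m := by
  rw [← wordPoly_eq]
  induction m with
  | zero => simp [wordPoly, blockPoly]
  | succ m ih =>
    rw [Nat.sum_antidiagonal_succ]
    simp only [pow_succ', pow_zero, one_mul, mul_assoc, ← mul_sum] at ih ⊢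
    rw [ih, blockPoly]; ring

/-- The companion of `sum_antidiagonal_mul_blockPoly` with `X c` in place of `t X c`. The two results
differ only in the factor `rowSum t c - X c` or `rowSum t c - t X c`. -/
theorem sum_antidiagonal_one_mul_blockPoly (t r : R) (c : ι) (m : ℕ) :
    ∑ p ∈ antidiagonal m, (C 1 * X c) ^ p.1 * blockPoly t r c p.2 =
      (C r * X c) ^ m + (rowSum t c - C t * X c) * rowHom t r c m := by
  induction m with
  | zero => simp [rowHom, blockPoly]
  | succ m ih =>
    rw [Nat.sum_antidiagonal_succ]
    simp only [pow_succ', pow_zero, one_mul, mul_assoc, ← mul_sum, C_1] at ih ⊢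
    rw [ih, blockPoly, wordPoly_eq, wordPoly_eq, rowHom]; ring

theorem sum_antidiagonal_prod {M : Type*} [CommSemiring M] (m : ι →₀ ℕ) (G : ι → ℕ → ℕ → M) :
    ∑ p ∈ antidiagonal m, ∏ c, G c (p.1 c) (p.2 c) =
      ∏ c, ∑ q ∈ antidiagonal (m c), G c q.1 q.2 := by
  rw [prod_univ_sum]
  refine sum_bij' (fun p _ c => (p.1 c, p.2 c))
    (fun f _ => (Finsupp.equivFunOnFinite.symm fun c => (f c).1,
      Finsupp.equivFunOnFinite.symm fun c => (f c).2)) ?_ ?_ ?_ ?_ ?_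
  · intro p hp
    rw [HasAntidiagonal.mem_antidiagonal] at hp
    simp [← hp]
  · intro f hf
    simp only [Fintype.mem_piFinset, HasAntidiagonal.mem_antidiagonal] at hf ⊢
    ext c; simp [hf]
  · intro p _; ext <;> simp
  · intro f _; ext <;> simp
  · intro p _; rfl

omit [LinearOrder ι] [Fintype ι] in
theorem prod_C_mul_X_pow (u : R) (m : ι →₀ ℕ) (S : Finset ι) (h : m.support ⊆ S) :
    ∏ c ∈ S, (C u * X c : MvPolynomial ι R) ^ m c = monomial m (u ^ m.degree) := by
  simp only [mul_pow]
  rw [prod_mul_distrib, monomial_eq, Finsupp.prod, prod_pow_eq_pow_sum, ← C_pow, Finsupp.degree_apply,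
    sum_subset h (by simp), prod_subset h (by simp +contextual)]

omit [Fintype ι] in
/-- Variables outside the support of a monomial may be set to zero before its coefficient is read
off. -/
theorem coeff_aeval_ite (S : Finset ι) (P : MvPolynomial ι R) (e : ι →₀ ℕ) (he : e.support ⊆ S) :
    coeff e (aeval (fun c => if c ∈ S then (X c : MvPolynomial ι R) else 0) P) = coeff e P := by
  induction P using MvPolynomial.induction_on' with
  | add p q hp hq => rw [map_add, coeff_add, coeff_add, hp, hq]
  | monomial u a =>
    rw [aeval_monomial, algebraMap_eq]
    by_cases hu : u.support ⊆ S
    · rw [monomial_eq]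
      congr 2
      exact Finsupp.prod_congr fun c hc => by rw [if_pos (hu hc)]
    · obtain ⟨c, hc, hcS⟩ := not_subset.1 hu
      have h1 : (u.prod fun c k => (if c ∈ S then (X c : MvPolynomial ι R) else 0) ^ k) = 0 :=
        prod_eq_zero hc (by beta_reduce; rw [if_neg hcS]; exact zero_pow (Finsupp.mem_support_iff.1 hc))
      rw [h1, mul_zero, coeff_zero, coeff_monomial, if_neg]
      rintro rfl
      exact hcS (he hc)

theorem aeval_rowSum (t : R) (S : Finset ι) (c : ι) :
    aeval (fun c => if c ∈ S then (X c : MvPolynomial ι R) else 0) (rowSum t c) =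
      ∑ b ∈ S with c ≤ b, X b + C t * ∑ b ∈ S with b ≤ c, X b := by
  have h : ∀ p : ι → Prop, [DecidablePred p] →
      ∑ b with p b, (if b ∈ S then (X b : MvPolynomial ι R) else 0) = ∑ b ∈ S with p b, X b := by
    intro p _
    rw [← sum_filter, filter_filter]
    congr 1; ext b; simp [and_comm]
  simp only [rowSum, map_add, map_mul, map_sum, aeval_X, h]
  simp

variable [IsDomain R]

omit [Fintype ι] in
theorem sum_X_ne_zero {S : Finset ι} (hS : S.Nonempty) :
    ∑ b ∈ S, (X b : MvPolynomial ι R) ≠ 0 := by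
  obtain ⟨c, hc⟩ := hS
  intro h
  have := congrArg (coeff (Finsupp.single c 1)) h
  simp [coeff_sum, coeff_X, Finsupp.single_left_inj, hc] at this

/-- The factors outside `S` already use up the exponents of `m` outside `S`, so there the variables
may be set to zero in the bracket, which then vanishes by `prod_sub_eq_mul_prod_sub`. -/
theorem coeff_prod_compl_mul_eq_zero (t r : R) (m : ι →₀ ℕ) {S : Finset ι} (hS : S.Nonempty)
    (Q : MvPolynomial ι R) :
    coeff m ((∏ c ∈ Sᶜ, (C r * X c) ^ m c) * (Q * (∏ c ∈ S, (rowSum t c - X c) -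
      C t * ∏ c ∈ S, (rowSum t c - C t * X c)))) = 0 := by
  have h1 : ∏ c ∈ Sᶜ, (C r * X c : MvPolynomial ι R) ^ m c =
      ∏ c ∈ Sᶜ, (C r * X c) ^ (m.filter (· ∉ S)) c :=
    prod_congr rfl fun c hc => by
      rw [Finsupp.filter_apply_pos (· ∉ S) _ (mem_compl.1 hc)]
  have h2 : m = m.filter (· ∉ S) + m.filter (· ∈ S) := by
    rw [add_comm, Finsupp.filter_add_filter_not]
  rw [h1, prod_C_mul_X_pow _ _ _ (fun c hc => by simp at hc; simp [hc])]
  nth_rw 1 [h2]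
  rw [coeff_monomial_mul, ← coeff_aeval_ite S _ _ (fun c hc => by simp at hc; simp [hc])]
  simp only [map_mul, map_sub, map_prod, aeval_rowSum, aeval_X, algHom_C, algebraMap_eq]
  have h3 : ∏ c ∈ S, (∑ b ∈ S with c ≤ b, X b + C t * ∑ b ∈ S with b ≤ c, X b -
      (if c ∈ S then (X c : MvPolynomial ι R) else 0)) =
      C t * ∏ c ∈ S, (∑ b ∈ S with c ≤ b, X b + C t * ∑ b ∈ S with b ≤ c, X b -
      C t * (if c ∈ S then (X c : MvPolynomial ι R) else 0)) := by
    have := prod_sub_eq_mul_prod_sub (C t) (fun c => (X c : MvPolynomial ι R)) S (sum_X_ne_zero hS)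
    have e : ∀ (A : ι → MvPolynomial ι R) (a : MvPolynomial ι R),
        ∏ c ∈ S, (A c - a * (if c ∈ S then X c else 0)) = ∏ c ∈ S, (A c - a * X c) :=
      fun A a => prod_congr rfl fun c hc => by rw [if_pos hc]
    have e' := e (fun c => ∑ b ∈ S with c ≤ b, X b + C t * ∑ b ∈ S with b ≤ c, X b) 1
    simp only [one_mul] at e'
    rw [e', this, e]
  rw [h3, sub_self, mul_zero, coeff_zero, mul_zero]

/-- The identity `(H(t) - t H(1)) N = (1 - t) H(r)`, coefficientwise, for the series `N` whose
coefficient at `m` is that of `X^m` in `∏ c, blockPoly t r c (m c)`, where `H(u)` is the series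
`∏ c, 1 / (1 - u X c)`. -/
theorem sum_antidiagonal_coeff_prod_blockPoly (t r : R) (m : ι →₀ ℕ) :
    ∑ p ∈ antidiagonal m, (t ^ p.1.degree - t) * coeff p.2 (∏ c, blockPoly t r c (p.2 c)) =
      (1 - t) * r ^ m.degree := by
  have key : ∀ u : R, ∑ p ∈ antidiagonal m, u ^ p.1.degree *
      coeff p.2 (∏ c, blockPoly t r c (p.2 c)) =
      coeff m (∏ c, ∑ q ∈ antidiagonal (m c), (C u * X c) ^ q.1 * blockPoly t r c q.2) := by
    intro u
    rw [← sum_antidiagonal_prod m fun c i j => (C u * X c) ^ i * blockPoly t r c j, coeff_sum]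
    refine sum_congr rfl fun p hp => ?_
    rw [prod_mul_distrib, prod_C_mul_X_pow _ _ _ (subset_univ _)]
    rw [HasAntidiagonal.mem_antidiagonal] at hp
    conv_rhs => rw [← hp]
    rw [coeff_monomial_mul]
  have h1 := key 1
  have ht := key t
  simp only [sum_antidiagonal_one_mul_blockPoly] at h1
  simp only [sum_antidiagonal_mul_blockPoly] at ht
  -- Expanding both products over the set `S` of columns where the second summand is chosen, only
  -- `S = ∅` survives.
  have expand : ∀ M : ι → MvPolynomial ι R,
      ∏ c, ((C r * X c) ^ m c + M c * rowHom t r c (m c)) =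
      ∑ S : Finset ι, (∏ c ∈ Sᶜ, (C r * X c) ^ m c) *
        ((∏ c ∈ S, rowHom t r c (m c)) * ∏ c ∈ S, M c) := by
    intro M
    simp_rw [add_comm ((C r * X _) ^ m _ : MvPolynomial ι R)]
    rw [Fintype.prod_add]
    refine sum_congr rfl fun S _ => ?_
    rw [prod_mul_distrib]; ring
  have : ∑ p ∈ antidiagonal m, (t ^ p.1.degree - t) * coeff p.2 (∏ c, blockPoly t r c (p.2 c)) =
      coeff m (∑ S : Finset ι, (∏ c ∈ Sᶜ, (C r * X c) ^ m c) * ((∏ c ∈ S, rowHom t r c (m c)) *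
        (∏ c ∈ S, (rowSum t c - X c) - C t * ∏ c ∈ S, (rowSum t c - C t * X c)))) := by
    simp only [sub_mul (_ ^ _), sum_sub_distrib, ht]
    have h1' : ∑ p ∈ antidiagonal m, t * coeff p.2 (∏ c, blockPoly t r c (p.2 c)) =
        t * ∑ p ∈ antidiagonal m, 1 ^ p.1.degree * coeff p.2 (∏ c, blockPoly t r c (p.2 c)) := by
      simp [mul_sum]
    rw [h1', h1, ← coeff_C_mul, ← coeff_sub, expand, expand, mul_sum, ← sum_sub_distrib]
    congr 1
    exact sum_congr rfl fun S _ => by ring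
  rw [this, coeff_sum, sum_eq_single ∅]
  · rw [prod_empty, prod_empty, prod_empty, compl_empty, prod_C_mul_X_pow _ _ _ (subset_univ _)]
    have : (1 * (1 - C t * 1) : MvPolynomial ι R) = C (1 - t) := by simp
    rw [this, mul_comm, coeff_C_mul, coeff_monomial, if_pos rfl]
  · intro S _ hS
    exact coeff_prod_compl_mul_eq_zero t r m (nonempty_iff_ne_empty.2 hS) _
  · simp

end Coeff

/-! ### Words filling the blocks -/

section Words

open MvPolynomial

variable {ι R : Type*} [LinearOrder ι] [CommRing R]

/-- The letters `(b, κ)` allowed in the block `c`, where `κ = false` means "marked": a letter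
`b < c` has to be marked, a letter `b > c` has to be unmarked, and `c` itself may be either. -/
def Allowed (c : ι) (a : ι × Bool) : Prop := (a.1 < c → a.2 = false) ∧ (c < a.1 → a.2 = true)

instance (c : ι) (a : ι × Bool) : Decidable (Allowed c a) := by unfold Allowed; infer_instance

/-- The weight of a letter: `t` records the mark. -/
noncomputable def letterWt (t : R) (a : ι × Bool) : MvPolynomial ι R :=
  (if a.2 then 1 else C t) * X a.1

/-- The weight of a word `g` in the block `c`, where `r` records the letters of the longest final
run of unmarked letters `c`. -/
noncomputable def wordWt (t r : R) (c : ι) {α : Type*} [LinearOrder α] [Fintype α]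
    (g : α → ι × Bool) : MvPolynomial ι R :=
  ∏ p, letterWt t (g p) * if ∀ p', p ≤ p' → g p' = (c, true) then C r else 1

/-- A word fills the block `c` if its letters are allowed there and it does not begin with the
marked letter `c`. -/
def FillsBlock (c : ι) {α : Type*} [LinearOrder α] (g : α → ι × Bool) : Prop :=
  (∀ p, Allowed c (g p)) ∧ ∀ p, g p = (c, false) → ∃ p', p' < p

/-- A new first letter joins the final run only if the whole word consists of unmarked letters
`c`. -/
theorem wordWt_cons (t r : R) (c : ι) {m : ℕ} (a : ι × Bool) (g : Fin m → ι × Bool) :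
    wordWt t r c (Fin.cons a g : Fin (m + 1) → ι × Bool) = letterWt t a * wordWt t r c g +
      if a = (c, true) ∧ g = fun _ => (c, true) then
        (C r - 1) * (letterWt t (c, true) * wordWt t r c fun _ : Fin m => (c, true)) else 0 := by
  unfold wordWt
  rw [Fin.prod_univ_succ]
  have h0 : (∀ p', (0 : Fin (m + 1)) ≤ p' → (Fin.cons a g : Fin (m + 1) → ι × Bool) p' = (c, true))
      ↔ a = (c, true) ∧ g = fun _ => (c, true) := by
    simp [Fin.forall_fin_succ, funext_iff]
  have hs : ∀ i : Fin m, (∀ p', i.succ ≤ p' → (Fin.cons a g : Fin (m + 1) → ι × Bool) p' = (c, true))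
      ↔ ∀ p', i ≤ p' → g p' = (c, true) := by
    intro i
    simp [Fin.forall_fin_succ]
  simp only [h0, hs, Fin.cons_zero, Fin.cons_succ]
  by_cases h : a = (c, true) ∧ g = fun _ => (c, true)
  · rw [if_pos h, if_pos h, h.1, h.2]; ring_nf
  · rw [if_neg h, if_neg h]; ring_nf

variable [Fintype ι]

theorem sum_letterWt (t : R) (c : ι) :
    ∑ a with Allowed c a, letterWt t a = (rowSum t c : MvPolynomial ι R) := by
  have h1 : ∀ b : ι, Allowed c (b, true) ↔ c ≤ b := by simp [Allowed]
  have h2 : ∀ b : ι, Allowed c (b, false) ↔ b ≤ c := by simp [Allowed]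
  rw [sum_filter, Fintype.sum_prod_type, rowSum, sum_filter, sum_filter, mul_sum, ← sum_add_distrib]
  refine sum_congr rfl fun b _ => ?_
  rw [Fintype.sum_bool, if_congr (h1 b) rfl rfl, if_congr (h2 b) rfl rfl]
  simp [letterWt]

theorem sum_allowed_cons {m : ℕ} (c : ι) (F : (Fin (m + 1) → ι × Bool) → MvPolynomial ι R) :
    ∑ g with (∀ p, Allowed c (g p)), F g =
      ∑ a with Allowed c a, ∑ g with (∀ p, Allowed c (g p)), F (Fin.cons a g) := by
  rw [← sum_product']
  symm
  refine sum_nbij' (fun x => Fin.cons x.1 x.2) (fun g => (g 0, Fin.tail g)) ?_ ?_ ?_ ?_ ?_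
  · rintro ⟨a, g⟩ h
    simpa [Fin.forall_fin_succ] using h
  · intro g h
    simpa [Fin.forall_fin_succ, Fin.tail] using h
  · rintro ⟨a, g⟩ _; simp
  · intro g _; simp
  · intro _ _; rfl

omit [Fintype ι] in
theorem allowed_self (c : ι) (κ : Bool) : Allowed c (c, κ) := by simp [Allowed]

omit [Fintype ι] in
theorem wordWt_const (t r : R) (c : ι) (m : ℕ) :
    wordWt t r c (fun _ : Fin m => (c, true)) = (C r * X c) ^ m := by
  simp [wordWt, letterWt, mul_comm]

theorem sum_allowed_wordWt (t r : R) (c : ι) (m : ℕ) :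
    ∑ g : Fin m → ι × Bool with (∀ p, Allowed c (g p)), wordWt t r c g = wordPoly t r c m := by
  induction m with
  | zero => simp [wordPoly, wordWt]
  | succ m ih =>
    simp only [sum_allowed_cons, wordWt_cons, sum_add_distrib, ← mul_sum, ih, ← sum_mul,
      sum_letterWt]
    have : ∀ x : MvPolynomial ι R,
        ∑ a with Allowed c a, ∑ g : Fin m → ι × Bool with (∀ p, Allowed c (g p)),
          (if a = (c, true) ∧ g = fun _ => (c, true) then x else 0) = x := by
      intro x
      rw [sum_eq_single (c, true), sum_eq_single fun _ => (c, true)]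
      · simp
      · intro g _ hg; simp [hg]
      · intro h; exact absurd (by simp [allowed_self]) h
      · intro a _ ha; simp [ha]
      · intro h; exact absurd (by simp [allowed_self]) h
    rw [this, wordWt_const, wordPoly]
    simp only [letterWt]
    simp
    ring

open Classical in
theorem sum_fillsBlock_fin (t r : R) (c : ι) (m : ℕ) :
    ∑ g : Fin m → ι × Bool with FillsBlock c g, wordWt t r c g = blockPoly t r c m := by
  cases m with
  | zero => simp [blockPoly, wordWt, FillsBlock]
  | succ m =>
    have h : ∀ g : Fin (m + 1) → ι × Bool,
        FillsBlock c g ↔ (∀ p, Allowed c (g p)) ∧ ¬ g 0 = (c, false) := by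
      intro g
      refine and_congr_right fun _ => ⟨fun h h0 => ?_, fun h p hp => ⟨0, ?_⟩⟩
      · obtain ⟨p', hp'⟩ := h 0 h0
        exact absurd hp' (Fin.not_lt_zero p')
      · exact Fin.pos_iff_ne_zero.2 fun h0 => h (h0 ▸ hp)
    have h2 : ∑ g : Fin (m + 1) → ι × Bool with (∀ p, Allowed c (g p)),
        (if g 0 = (c, false) then wordWt t r c g else 0) = C t * X c * wordPoly t r c m := by
      rw [sum_allowed_cons, sum_eq_single (c, false)]
      · simp [wordWt_cons, ← mul_sum, sum_allowed_wordWt, letterWt]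
      · intro a _ ha; simp [ha]
      · intro h; exact absurd (by simp [allowed_self]) h
    rw [blockPoly, ← h2, ← sum_allowed_wordWt, ← sum_sub_distrib, filter_congr fun g _ => h g,
      ← filter_filter, sum_filter]
    refine sum_congr rfl fun g _ => ?_
    split_ifs <;> simp

open Classical in
theorem sum_fillsBlock (t r : R) (c : ι) (α : Type*) [LinearOrder α] [Fintype α] :
    ∑ g : α → ι × Bool with FillsBlock c g, wordWt t r c g = blockPoly t r c (Fintype.card α) := by
  rw [← sum_fillsBlock_fin]
  have e := monoEquivOfFin α rfl
  symm
  refine sum_equiv (Equiv.arrowCongr e.toEquiv (Equiv.refl _)) ?_ ?_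
  · intro g
    rw [mem_filter_univ, mem_filter_univ]
    refine and_congr ?_ ?_
    · rw [← e.toEquiv.forall_congr_right]; simp
    · rw [← e.toEquiv.forall_congr_right]
      refine forall_congr' fun p => imp_congr (by simp) ?_
      rw [← e.toEquiv.exists_congr_right]; simp
  · intro g _
    unfold wordWt
    rw [← e.toEquiv.prod_comp]
    refine prod_congr rfl fun p _ => ?_
    congr 1
    · simp
    · congr 1
      rw [← e.toEquiv.forall_congr_right]; simp

/-- A filling of the blocks of `s`: position `p` lies in the block `s p`, and the restriction of
`f` to each block fills it. -/
def Fills {n : ℕ} (s : Fin n → ι) (f : Fin n → ι × Bool) : Prop :=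
  (∀ p, Allowed (s p) (f p)) ∧ ∀ p, f p = (s p, false) → ∃ p' < p, s p' = s p

open Classical in
/-- Fillings are chosen block by block. -/
theorem sum_fills (t r : R) {n : ℕ} (s : Fin n → ι) :
    ∑ f with Fills s f, ∏ p, (letterWt t (f p) *
        if ∀ p', p ≤ p' → s p' = s p → f p' = (s p', true) then C r else 1) =
      ∏ c, blockPoly t r c (Fintype.card {p // s p = c}) := by
  simp_rw [← sum_fillsBlock]
  rw [prod_univ_sum]
  refine sum_nbij' (fun f c p => f p.1) (fun h p => h (s p) ⟨p, rfl⟩) ?_ ?_ ?_ ?_ ?_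
  · intro f hf
    simp only [mem_filter, mem_univ, true_and, Fintype.mem_piFinset] at hf ⊢
    intro c
    refine ⟨fun p => by simpa [p.2] using hf.1 p.1, fun p hp => ?_⟩
    obtain ⟨p', h1, h2⟩ := hf.2 p.1 (by rw [p.2]; exact hp)
    exact ⟨⟨p', h2.trans p.2⟩, h1⟩
  · intro h hh
    simp only [mem_filter, mem_univ, true_and, Fintype.mem_piFinset] at hh ⊢
    refine ⟨fun p => (hh (s p)).1 ⟨p, rfl⟩, fun p hp => ?_⟩
    obtain ⟨p', h1⟩ := (hh (s p)).2 ⟨p, rfl⟩ hp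
    exact ⟨p'.1, h1, p'.2⟩
  · intro f _; rfl
  · intro h _
    funext c p
    obtain ⟨p, rfl⟩ := p
    rfl
  · intro f _
    unfold wordWt
    rw [← Fintype.prod_fiberwise s]
    refine prod_congr rfl fun c _ => prod_congr rfl fun p _ => ?_
    congr 1
    congr 1
    obtain ⟨p, rfl⟩ := p
    refine propext ⟨fun h p' hp' => ?_, fun h p' hp' hs => ?_⟩
    · exact (h p'.1 hp' p'.2).trans (by rw [p'.2])
    · exact (h ⟨p', hs⟩ hp').trans (by rw [hs])

end Words

/-! ### Permutations and fillings -/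

section Sorting

variable {ι : Type*} [LinearOrder ι] {n : ℕ}

/-- The sorting key of the position `i`: excedances come first, and ties are broken by values. -/
def key (σ : Equiv.Perm (Fin n)) (i : Fin n) : Bool ×ₗ Fin n := toLex (decide (σ i ≤ i), σ i)

/-- A labelling `s` is compatible with `σ` if the keys increase along each block of equal labels. -/
def Compat (σ : Equiv.Perm (Fin n)) (s : Fin n → ι) : Prop :=
  ∀ i j, i < j → s i = s j → key σ i < key σ j

/-- The filling attached to a permutation: at `p` it records the block containing `σ⁻¹ p`, and,
by the mark, whether `σ⁻¹ p` is an excedance. -/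
def toFilling (s : Fin n → ι) (σ : Equiv.Perm (Fin n)) (p : Fin n) : ι × Bool :=
  (s (σ.symm p), decide (p ≤ σ.symm p))

omit [LinearOrder ι] in
theorem toFilling_apply_apply (s : Fin n → ι) (σ : Equiv.Perm (Fin n)) (i : Fin n) :
    toFilling s σ (σ i) = (s i, decide (σ i ≤ i)) := by simp [toFilling]

variable {s : Fin n → ι} (hs : Monotone s)

include hs in
theorem fills_toFilling (σ : Equiv.Perm (Fin n)) : Fills s (toFilling s σ) := by
  refine ⟨fun p => ⟨fun h => ?_, fun h => ?_⟩, fun p hp => ?_⟩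
  · exact decide_eq_false (not_le.2 (hs.reflect_lt h))
  · exact decide_eq_true (hs.reflect_lt h).le
  · obtain ⟨h1, h2⟩ := Prod.mk.inj hp
    exact ⟨σ.symm p, not_le.1 (of_decide_eq_false h2), h1⟩

include hs in
theorem eq_sort_toFilling {σ : Equiv.Perm (Fin n)} (hσ : Compat σ s) :
    Tuple.sort (toLex ∘ toFilling s σ) = σ := by
  symm
  rw [Tuple.eq_sort_iff]
  simp only [Function.comp_apply, toFilling_apply_apply]
  constructor
  · intro i j hij
    simp only [Function.comp_apply, toFilling_apply_apply]
    rcases hij.eq_or_lt with rfl | hij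
    · exact le_rfl
    rw [Prod.Lex.toLex_le_toLex]
    rcases (hs hij.le).lt_or_eq with h | h
    · exact Or.inl h
    · refine Or.inr ⟨h, ?_⟩
      rcases Prod.Lex.toLex_lt_toLex.1 (hσ i j hij h) with h' | h'
      · exact h'.le
      · exact h'.1.le
  · intro i j hij h
    obtain ⟨h1, h2⟩ := Prod.mk.inj (toLex.injective h)
    exact ((Prod.Lex.toLex_lt_toLex.1 (hσ i j hij h1)).resolve_left fun h' => h'.ne h2).2

/-- If the labels of `f` are a rearrangement of the monotone `s`, sorting `f` brings them back
to `s`. -/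
theorem fst_sort (hs : Monotone s) {f : Fin n → ι × Bool}
    (hf : ∃ τ : Equiv.Perm (Fin n), (Prod.fst ∘ f) ∘ τ = s) (i : Fin n) :
    (f (Tuple.sort (toLex ∘ f) i)).1 = s i := by
  obtain ⟨τ, hτ⟩ := hf
  have h1 : Monotone ((Prod.fst ∘ f) ∘ Tuple.sort (toLex ∘ f)) := fun i j hij => by
    rcases Prod.Lex.toLex_le_toLex.1 (Tuple.monotone_sort (toLex ∘ f) hij) with h | h
    · exact h.le
    · exact h.1.le
  have h2 : Monotone ((Prod.fst ∘ f) ∘ τ) := by rw [hτ]; exact hs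
  have := Tuple.unique_monotone h1 h2
  rw [hτ] at this
  exact congrFun this i

/-- In a filling sorted by `σ`, the marks sit exactly on the excedance values of `σ`. -/
theorem snd_sort (hs : Monotone s) {f : Fin n → ι × Bool} (hF : Fills s f)
    (hf : ∃ τ : Equiv.Perm (Fin n), (Prod.fst ∘ f) ∘ τ = s) (i : Fin n) :
    (f (Tuple.sort (toLex ∘ f) i)).2 =
      decide (Tuple.sort (toLex ∘ f) i ≤ i) := by
  have hfst := fst_sort hs hf
  obtain ⟨hmono, htie⟩ := Tuple.eq_sort_iff.1 (rfl : Tuple.sort (toLex ∘ f) = _)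
  set σ := Tuple.sort (toLex ∘ f) with hσ
  have hsnd : ∀ {a b}, a ≤ b → s a = s b → (f (σ a)).2 ≤ (f (σ b)).2 := fun {a b} hab h => by
    rcases Prod.Lex.toLex_le_toLex.1 (hmono hab) with h' | h'
    · exact absurd h' (by rw [hfst, hfst, h]; exact lt_irrefl _)
    · exact h'.2
  have hval : ∀ {a b}, a ≤ b → s a = s b → (f (σ a)).2 = (f (σ b)).2 → σ a ≤ σ b :=
    fun {a b} hab h h2 => by
      rcases hab.eq_or_lt with rfl | hab
      · exact le_rfl
      · refine (htie a b hab (congrArg toLex (Prod.ext ?_ h2))).le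
        rw [hfst, hfst, h]
  have hall := fun j => hF.1 (σ j)
  simp only [Allowed, hfst] at hall
  rcases lt_trichotomy (s i) (s (σ i)) with h | h | h
  · rw [(hall i).1 h, decide_eq_false (not_le.2 (hs.reflect_lt h))]
  · cases hκ : (f (σ i)).2 with
    | false =>
      -- If `σ i ≤ i`, then `σ` permutes the block up to `i`, and all its letters there are marked;
      -- but the first position of a block must not carry its own marked letter.
      symm
      rw [decide_eq_false_iff_not]
      intro hle
      set T : Finset (Fin n) := {j | j ≤ i ∧ s j = s i} with hT
      have hmark : ∀ j ∈ T, (f (σ j)).2 = false := fun j hj => by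
        simp only [hT, mem_filter_univ] at hj
        have := hsnd hj.1 hj.2
        rw [hκ] at this
        exact le_bot_iff.1 this
      have hmaps : ∀ j ∈ T, σ j ∈ T := fun j hj => by
        have hm := hmark j hj
        simp only [hT, mem_filter_univ] at hj ⊢
        have h1 : σ j ≤ σ i := hval hj.1 hj.2 (hm.trans hκ.symm)
        refine ⟨h1.trans hle, ((hs h1).trans h.ge).eq_of_not_lt fun hlt => ?_⟩
        have := (hall j).2 (by rw [hj.2]; exact hlt)
        rw [hm] at this
        exact Bool.false_ne_true this
      have hiT : i ∈ T := by simp [hT]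
      have hmin := T.min'_mem ⟨i, hiT⟩
      have hpre := Equiv.Perm.perm_symm_on_of_perm_on_finset hmaps hmin
      have hm := hmark _ hpre
      have hfst' := hfst (σ.symm (T.min' ⟨i, hiT⟩))
      rw [Equiv.apply_symm_apply] at hm hfst'
      have e1 : s (T.min' ⟨i, hiT⟩) = s i := (mem_filter.1 hmin).2.2
      have e2 : s (σ.symm (T.min' ⟨i, hiT⟩)) = s i := (mem_filter.1 hpre).2.2
      obtain ⟨p', hp', hsp'⟩ := hF.2 _ (Prod.ext (hfst'.trans (e2.trans e1.symm)) hm)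
      refine absurd hp' (not_lt.2 (T.min'_le p' ?_))
      simp only [hT, mem_filter_univ]
      exact ⟨hp'.le.trans (mem_filter.1 hmin).2.1, hsp'.trans e1⟩
    | true =>
      -- If `i < σ i`, then `σ` permutes the block from `i` on but avoids the value `i`.
      symm
      rw [decide_eq_true_iff]
      by_contra hlt
      rw [not_le] at hlt
      set T : Finset (Fin n) := {j | i ≤ j ∧ s j = s i} with hT
      have hbig : ∀ j ∈ T, i < σ j ∧ σ j ∈ T := fun j hj => by
        simp only [hT, mem_filter_univ] at hj ⊢
        have hm : (f (σ j)).2 = true := by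
          have := hsnd hj.1 hj.2.symm
          rw [hκ] at this
          exact top_le_iff.1 this
        have h1 : σ i ≤ σ j := hval hj.1 hj.2.symm (hκ.trans hm.symm)
        refine ⟨hlt.trans_le h1, hlt.le.trans h1, ((h.le.trans (hs h1)).eq_of_not_lt fun h2 => ?_).symm⟩
        have := (hall j).1 (by rw [hj.2]; exact h2)
        rw [hm] at this
        exact Bool.false_ne_true this.symm
      have hiT : i ∈ T := by simp [hT]
      have hpre := Equiv.Perm.perm_symm_on_of_perm_on_finset (fun j hj => (hbig j hj).2) hiT
      have := (hbig _ hpre).1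
      rw [Equiv.apply_symm_apply] at this
      exact lt_irrefl _ this
  · rw [(hall i).2 h, decide_eq_true (hs.reflect_lt h).le]

theorem toFilling_sort (hs : Monotone s) {f : Fin n → ι × Bool} (hF : Fills s f)
    (hf : ∃ τ : Equiv.Perm (Fin n), (Prod.fst ∘ f) ∘ τ = s) :
    toFilling s (Tuple.sort (toLex ∘ f)) = f := by
  funext p
  obtain ⟨i, rfl⟩ := (Tuple.sort (toLex ∘ f)).surjective p
  rw [toFilling_apply_apply, ← snd_sort hs hF hf, ← fst_sort hs hf]

theorem compat_sort (hs : Monotone s) {f : Fin n → ι × Bool} (hF : Fills s f)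
    (hf : ∃ τ : Equiv.Perm (Fin n), (Prod.fst ∘ f) ∘ τ = s) :
    Compat (Tuple.sort (toLex ∘ f)) s := by
  intro i j hij h
  obtain ⟨hmono, htie⟩ := Tuple.eq_sort_iff.1 (rfl : Tuple.sort (toLex ∘ f) = _)
  rw [key, key, ← snd_sort hs hF hf, ← snd_sort hs hF hf, Prod.Lex.toLex_lt_toLex]
  have hfst : (f (Tuple.sort (toLex ∘ f) i)).1 = (f (Tuple.sort (toLex ∘ f) j)).1 := by
    rw [fst_sort hs hf, fst_sort hs hf, h]
  rcases Prod.Lex.toLex_le_toLex.1 (hmono hij.le) with h' | h'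
  · exact absurd h' (by rw [hfst]; exact lt_irrefl _)
  · rcases h'.2.lt_or_eq with h2 | h2
    · exact Or.inl h2
    · exact Or.inr ⟨h2, htie i j hij (congrArg toLex (Prod.ext hfst h2))⟩

/-- A position is fixed exactly if it belongs to the final run of unmarked own letters of its
block. -/
theorem apply_eq_self_iff (hs : Monotone s) {σ : Equiv.Perm (Fin n)} (hσ : Compat σ s)
    (p : Fin n) :
    σ p = p ↔ ∀ p', p ≤ p' → s p' = s p → toFilling s σ p' = (s p', true) := by
  set T : Finset (Fin n) := {j | p ≤ j ∧ s j = s p} with hT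
  constructor
  · intro hp
    have hbig : ∀ j ∈ T, σ j ≤ j ∧ σ j ∈ T := fun j hj => by
      simp only [hT, mem_filter_univ] at hj ⊢
      rcases hj.1.eq_or_lt with rfl | hlt
      · simp [hp]
      have h1 := Prod.Lex.toLex_lt_toLex.1 (hσ p j hlt hj.2.symm)
      simp only [hp, le_refl, decide_true] at h1
      obtain ⟨h2, h3⟩ := h1.resolve_left (fun h => absurd h (by simp))
      have h4 := of_decide_eq_true h2.symm
      exact ⟨h4, h3.le, le_antisymm ((hs h4).trans hj.2.le) (hs h3.le)⟩
    intro p' hp' hsp'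
    have hpre := Equiv.Perm.perm_symm_on_of_perm_on_finset (fun j hj => (hbig j hj).2)
      (show p' ∈ T by simp [hT, hp', hsp'])
    have h1 := (hbig _ hpre).1
    rw [Equiv.apply_symm_apply] at h1
    have h2 : s (σ.symm p') = s p := (mem_filter.1 hpre).2.2
    exact Prod.ext (h2.trans hsp'.symm) (decide_eq_true h1)
  · intro h
    have hinv : ∀ j ∈ T, σ.symm j ∈ T ∧ j ≤ σ.symm j := fun j hj => by
      simp only [hT, mem_filter_univ] at hj ⊢
      obtain ⟨h1, h2⟩ := Prod.mk.inj (h j hj.1 hj.2)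
      have h3 : j ≤ σ.symm j := of_decide_eq_true h2
      exact ⟨⟨hj.1.trans h3, h1.trans hj.2⟩, h3⟩
    have hpT : p ∈ T := by simp [hT]
    have h1 : σ p ∈ T :=
      Equiv.Perm.perm_symm_on_of_perm_on_finset (f := σ.symm) (fun j hj => (hinv j hj).1) hpT
    have h2 := (hinv _ h1).2
    rw [Equiv.symm_apply_apply] at h2
    exact le_antisymm h2 (mem_filter.1 h1).2.1

open Classical in
/-- Sorting turns fillings of the blocks of `s` into permutations compatible with `s`, carrying
marks to excedances and final runs to fixed points. -/
theorem sum_compat_eq_sum_fills [Fintype ι] {R : Type*} [CommRing R] (t r : R)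
    (hs : Monotone s) :
    ∑ σ with Compat σ s, t ^ exc σ * r ^ fix σ =
      ∑ f with Fills s f ∧ ∃ τ : Equiv.Perm (Fin n), (Prod.fst ∘ f) ∘ τ = s,
        ∏ p, ((if (f p).2 then 1 else t) *
          if ∀ p', p ≤ p' → s p' = s p → f p' = (s p', true) then r else 1) := by
  refine sum_nbij' (toFilling s) (fun f => Tuple.sort (toLex ∘ f)) ?_ ?_ ?_ ?_ ?_
  · intro σ _
    simp only [mem_filter_univ]
    exact ⟨fills_toFilling hs σ, σ, by funext i; simp [toFilling]⟩
  · intro f hf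
    simp only [mem_filter_univ] at hf ⊢
    exact compat_sort hs hf.1 hf.2
  · intro σ hσ
    simp only [mem_filter_univ] at hσ
    exact eq_sort_toFilling hs hσ
  · intro f hf
    simp only [mem_filter_univ] at hf
    exact toFilling_sort hs hf.1 hf.2
  · intro σ hσ
    simp only [mem_filter_univ] at hσ
    rw [prod_mul_distrib]
    congr 1
    · rw [← Equiv.prod_comp σ]
      simp only [toFilling_apply_apply, decide_eq_true_eq]
      rw [prod_ite, prod_const_one, one_mul, prod_const, exc, excSet]
      simp
    · simp only [← apply_eq_self_iff hs hσ]
      rw [prod_ite, prod_const_one, mul_one, prod_const, fix]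

end Sorting

/-! ### Words by content -/

section Content

open MvPolynomial

variable {ι : Type*} {n : ℕ}

/-- The content of a word: how often each letter occurs. -/
noncomputable def content (s : Fin n → ι) : ι →₀ ℕ := ∑ p, Finsupp.single (s p) 1

variable [LinearOrder ι]

theorem content_apply (s : Fin n → ι) (c : ι) : content s c = Fintype.card {p // s p = c} := by
  simp [content, Finsupp.finsetSum_apply, Finsupp.single_apply, Fintype.card_subtype]

omit [LinearOrder ι] in
theorem content_comp_perm (s : Fin n → ι) (τ : Equiv.Perm (Fin n)) :
    content (s ∘ τ) = content s :=
  Equiv.sum_comp τ fun p => Finsupp.single (s p) 1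

theorem content_eq_iff {a b : Fin n → ι} :
    content a = content b ↔ ∃ τ : Equiv.Perm (Fin n), a ∘ τ = b := by
  constructor
  · intro h
    have e : ∀ c, Nonempty ({p // b p = c} ≃ {p // a p = c}) := fun c =>
      Fintype.card_eq.1 (by rw [← content_apply, ← content_apply, h])
    exact ⟨Equiv.ofFiberEquiv fun c => (e c).some, funext fun p => Equiv.ofFiberEquiv_map _ p⟩
  · rintro ⟨τ, rfl⟩
    exact (content_comp_perm a τ).symm

variable [Fintype ι]

theorem content_mem (s : Fin n → ι) : content s ∈ finsuppAntidiag univ n := by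
  rw [mem_finsuppAntidiag]
  refine ⟨?_, subset_univ _⟩
  simp only [content_apply]
  rw [← Fintype.card_sigma, Fintype.card_congr (Equiv.sigmaFiberEquiv s), Fintype.card_fin]

theorem prod_comp_eq_prod_pow_content {R : Type*} [CommSemiring R] (x : ι → R) (s : Fin n → ι) :
    ∏ p, x (s p) = ∏ c, x c ^ content s c := by
  rw [← Fintype.prod_fiberwise s]
  refine prod_congr rfl fun c _ => ?_
  rw [content_apply, ← card_univ, ← prod_const]
  exact prod_congr rfl fun p _ => by rw [p.2]

theorem exists_monotone_content {m : ι →₀ ℕ} (hm : m ∈ finsuppAntidiag univ n) :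
    ∃ s : Fin n → ι, Monotone s ∧ content s = m := by
  rw [mem_finsuppAntidiag] at hm
  have e : Fin n ≃ Σ c, Fin (m c) := Fintype.equivOfCardEq (by simp [hm.1])
  set a : Fin n → ι := fun p => (e p).1 with ha
  refine ⟨a ∘ Tuple.sort a, Tuple.monotone_sort a, ?_⟩
  rw [content_comp_perm]
  ext c
  rw [content_apply, Fintype.card_congr (e.subtypeEquiv (q := fun x => x.1 = c) fun _ => Iff.rfl),
    Fintype.card_congr (Equiv.sigmaSubtype c), Fintype.card_fin]

open Classical in
theorem sum_monotone_content {M : Type*} [AddCommMonoid M] (F : (ι →₀ ℕ) → M) :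
    ∑ s : Fin n → ι with Monotone s, F (content s) = ∑ m ∈ finsuppAntidiag univ n, F m := by
  refine sum_bij (fun s _ => content s) (fun s _ => content_mem s) ?_ ?_ (fun _ _ => rfl)
  · intro a ha b hb h
    rw [mem_filter_univ] at ha hb
    obtain ⟨τ, rfl⟩ := content_eq_iff.1 h
    exact Tuple.unique_monotone (σ := 1) ha hb
  · intro m hm
    obtain ⟨s, h1, h2⟩ := exists_monotone_content hm
    exact ⟨s, by rwa [mem_filter_univ], h2⟩

variable {R : Type*} [CommRing R]

open Classical in
/-- Among all fillings, those with the content of `s` come from permutations compatible with `s`. -/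
theorem sum_compat_eq_coeff (t r : R) {s : Fin n → ι} (hs : Monotone s) :
    ∑ σ with Compat σ s, t ^ exc σ * r ^ fix σ =
      coeff (content s) (∏ c, blockPoly t r c (content s c)) := by
  simp only [content_apply _ _]
  rw [← sum_fills, coeff_sum, sum_compat_eq_sum_fills t r hs, ← filter_filter, sum_filter]
  refine sum_congr rfl fun f _ => ?_
  have h : ∏ p, (letterWt t (f p) *
      if ∀ p', p ≤ p' → s p' = s p → f p' = (s p', true) then (C r : MvPolynomial ι R) else 1) =
      monomial (content (Prod.fst ∘ f)) (∏ p, ((if (f p).2 then 1 else t) *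
          if ∀ p', p ≤ p' → s p' = s p → f p' = (s p', true) then r else 1)) := by
    rw [← mul_one (∏ p, _ : R), ← C_mul_monomial, content, monomial_sum_one, map_prod,
      ← prod_mul_distrib]
    refine prod_congr rfl fun p _ => ?_
    rw [letterWt]
    simp only [map_mul, apply_ite (C : R → MvPolynomial ι R), C_1, Function.comp_apply, X]
    ring
  rw [h, coeff_monomial]
  exact if_congr content_eq_iff.symm rfl rfl

variable (n) in
open Classical in
/-- The sum of `∏ x (s p)` over the monotone words of length `n`: the complete homogeneous
symmetric polynomial `h_n(x)`. -/
noncomputable def monoSum (x : ι → R) : R :=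
  ∑ s : Fin n → ι with Monotone s, ∏ p, x (s p)

variable (n) in
open Classical in
/-- The sum of `t^exc r^fix ∏ x (s p)` over all permutations with a compatible monotone word. -/
noncomputable def compatSum (t r : R) (x : ι → R) : R :=
  ∑ s : Fin n → ι with Monotone s, (∏ p, x (s p)) * ∑ σ with Compat σ s, t ^ exc σ * r ^ fix σ

theorem monoSum_eq (x : ι → R) :
    monoSum n x = ∑ m ∈ finsuppAntidiag univ n, ∏ c, x c ^ m c := by
  rw [monoSum, ← sum_monotone_content]
  exact sum_congr rfl fun s _ => prod_comp_eq_prod_pow_content x s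

theorem compatSum_eq (t r : R) (x : ι → R) :
    compatSum n t r x = ∑ m ∈ finsuppAntidiag univ n, (∏ c, x c ^ m c) *
      coeff m (∏ c, blockPoly t r c (m c)) := by
  classical
  rw [compatSum, ← sum_monotone_content]
  refine sum_congr rfl fun s hs => ?_
  rw [prod_comp_eq_prod_pow_content, sum_compat_eq_coeff t r (mem_filter.1 hs).2]

theorem sum_finsuppAntidiag_antidiagonal {M : Type*} [AddCommMonoid M]
    (F : (ι →₀ ℕ) → (ι →₀ ℕ) → M) :
    ∑ m ∈ finsuppAntidiag (univ : Finset ι) n, ∑ p ∈ antidiagonal m, F p.1 p.2 =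
      ∑ q ∈ antidiagonal n, ∑ a ∈ finsuppAntidiag univ q.1, ∑ b ∈ finsuppAntidiag univ q.2,
        F a b := by
  simp_rw [← sum_product']
  rw [sum_sigma', sum_sigma']
  refine sum_nbij' (fun z => ⟨(∑ c, z.2.1 c, ∑ c, z.2.2 c), z.2⟩) (fun z => ⟨z.2.1 + z.2.2, z.2⟩)
    ?_ ?_ ?_ ?_ ?_
  · rintro ⟨m, p⟩ h
    simp only [mem_sigma, mem_finsuppAntidiag, HasAntidiagonal.mem_antidiagonal, mem_product] at h ⊢
    obtain ⟨⟨h1, -⟩, rfl⟩ := h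
    simpa [sum_add_distrib] using h1
  · rintro ⟨q, a, b⟩ h
    simp only [mem_sigma, mem_finsuppAntidiag, HasAntidiagonal.mem_antidiagonal, mem_product] at h ⊢
    simpa [sum_add_distrib, h.2.1.1, h.2.2.1] using h.1
  · rintro ⟨m, p⟩ h
    simp only [mem_sigma, HasAntidiagonal.mem_antidiagonal] at h
    simp [h.2]
  · rintro ⟨⟨i, j⟩, a, b⟩ h
    simp only [mem_sigma, mem_finsuppAntidiag, mem_product] at h
    simp [h.2.1.1, h.2.2.1]
  · intro _ _; rfl

/-- The degree `n` part of the identity `(H(t) - t H(1)) N = (1 - t) H(r)`, evaluated at `x`. -/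
theorem sum_monoSum_mul_compatSum [IsDomain R] (t r : R) (x : ι → R) :
    ∑ q ∈ antidiagonal n, (t ^ q.1 - t) * (monoSum q.1 x * compatSum q.2 t r x) =
      (1 - t) * r ^ n * monoSum n x := by
  have hdeg : ∀ {k} {a : ι →₀ ℕ}, a ∈ finsuppAntidiag univ k → a.degree = k := fun {k a} h => by
    rw [← (mem_finsuppAntidiag.1 h).1, Finsupp.degree_eq_sum]
  have h1 : ∀ q ∈ antidiagonal n, (t ^ q.1 - t) * (monoSum q.1 x * compatSum q.2 t r x) =
      ∑ a ∈ finsuppAntidiag univ q.1, ∑ b ∈ finsuppAntidiag univ q.2,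
        (t ^ a.degree - t) * ((∏ c, x c ^ a c) *
          ((∏ c, x c ^ b c) * coeff b (∏ c, blockPoly t r c (b c)))) := by
    intro q _
    rw [monoSum_eq, compatSum_eq, sum_mul_sum, mul_sum]
    refine sum_congr rfl fun a ha => ?_
    rw [mul_sum, hdeg ha]
  rw [sum_congr rfl h1, ← sum_finsuppAntidiag_antidiagonal fun a b => (t ^ a.degree - t) *
    ((∏ c, x c ^ a c) * ((∏ c, x c ^ b c) * coeff b (∏ c, blockPoly t r c (b c)))),
    monoSum_eq, mul_sum]
  refine sum_congr rfl fun m hm => ?_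
  rw [← hdeg hm, ← sum_antidiagonal_coeff_prod_blockPoly, sum_mul]
  refine sum_congr rfl fun p hp => ?_
  rw [HasAntidiagonal.mem_antidiagonal] at hp
  rw [← hp]
  simp only [Finsupp.add_apply, pow_add, prod_mul_distrib]
  ring

end Content

/-! ### The statistic `maj - exc` as a sum over descents -/

section Dex

variable {n : ℕ}

/-- The descent set of `σ` in the order that puts excedances first: all `i` such that `i + 1` is a
position and `key σ (i + 1) < key σ i`. -/
def dexSet (σ : Equiv.Perm (Fin n)) : Finset (Fin n) :=
  univ.filter fun i => ∃ h : (i : ℕ) + 1 < n, key σ ⟨(i : ℕ) + 1, h⟩ < key σ i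

/-- The sum of the elements of `dexSet`, positions being counted from `1`. -/
def dexSum (σ : Equiv.Perm (Fin n)) : ℕ := ∑ i ∈ dexSet σ, ((i : ℕ) + 1)

theorem sum_filter_succ_lt {N : ℕ} (P : Fin (N + 1) → Fin (N + 1) → Prop)
    [DecidableRel P] (F : Fin (N + 1) → ℕ) :
    ∑ i ∈ univ.filter (fun i : Fin (N + 1) => ∃ h : (i : ℕ) + 1 < N + 1, P ⟨(i : ℕ) + 1, h⟩ i), F i =
      ∑ i : Fin N, if P i.succ i.castSucc then F i.castSucc else 0 := by
  rw [sum_filter, Fin.sum_univ_castSucc]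
  simp [Fin.succ]

/-- Descents and `dexSet` differ at `i` only if exactly one of `i`, `i + 1` is an excedance: then
there is a descent if it is `i`, and an element of `dexSet` if it is `i + 1`. -/
theorem ite_descent_add (N : ℕ) (σ : Equiv.Perm (Fin (N + 1))) (i : Fin N) :
    ((if σ i.succ < σ i.castSucc then 1 else 0) + if i.succ < σ i.succ then 1 else 0) =
      (if key σ i.succ < key σ i.castSucc then 1 else 0) +
        if i.castSucc < σ i.castSucc then 1 else 0 := by
  have hne : σ i.succ ≠ σ i.castSucc := fun h => by
    have := σ.injective h
    simp [Fin.ext_iff] at this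
  rw [Ne, Fin.ext_iff] at hne
  simp only [key, Prod.Lex.toLex_lt_toLex, Bool.lt_iff, decide_eq_false_iff_not, decide_eq_true_eq,
    decide_eq_decide, Fin.lt_def, Fin.le_def, Fin.val_succ, Fin.val_castSucc]
  by_cases h1 : (σ i.succ : ℕ) < σ i.castSucc <;> by_cases h2 : (i : ℕ) + 1 < σ i.succ <;>
    by_cases h3 : (i : ℕ) < σ i.castSucc <;> simp [h1, h2, h3] <;> omega

/-- Summing `ite_descent_add` with weights `i + 1`: shifting the excedances by one position lowers
their total by `exc σ`, whence `maj - exc = dexSum`. -/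
theorem maj_eq_dexSum_add_exc (σ : Equiv.Perm (Fin n)) : maj σ = dexSum σ + exc σ := by
  cases n with
  | zero => simp [maj, dexSum, exc, desSet, dexSet, excSet]
  | succ N =>
    have h1 : maj σ = ∑ i : Fin N, if σ i.succ < σ i.castSucc then ((i : ℕ) + 1) else 0 :=
      sum_filter_succ_lt (fun a b => σ a < σ b) _
    have h2 : dexSum σ = ∑ i : Fin N, if key σ i.succ < key σ i.castSucc then ((i : ℕ) + 1) else 0 :=
      sum_filter_succ_lt (fun a b => key σ a < key σ b) _
    have h3 : exc σ = ∑ i : Fin (N + 1), if i < σ i then 1 else 0 := by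
      rw [exc, excSet, card_filter]
    have h4 : ∑ i : Fin (N + 1), (if i < σ i then ((i : ℕ) + 1) else 0) =
        ∑ i : Fin N, if i.castSucc < σ i.castSucc then ((i : ℕ) + 1) else 0 := by
      rw [Fin.sum_univ_castSucc, if_neg (not_lt.2 (Fin.le_last _)), add_zero]
      rfl
    have h5 : ∑ i : Fin (N + 1), (if i < σ i then ((i : ℕ) + 1) else 0) =
        exc σ + ∑ i : Fin N, if i.succ < σ i.succ then ((i : ℕ) + 1) else 0 := by
      rw [h3, Fin.sum_univ_succ, Fin.sum_univ_succ, add_assoc, ← sum_add_distrib]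
      congr 1
      refine sum_congr rfl fun i _ => ?_
      split_ifs
      · simp; ring
      · rfl
    have h6 : (∑ i : Fin N, if σ i.succ < σ i.castSucc then ((i : ℕ) + 1) else 0) +
        ∑ i : Fin N, (if i.succ < σ i.succ then ((i : ℕ) + 1) else 0) =
        (∑ i : Fin N, if key σ i.succ < key σ i.castSucc then ((i : ℕ) + 1) else 0) +
        ∑ i : Fin N, if i.castSucc < σ i.castSucc then ((i : ℕ) + 1) else 0 := by
      rw [← sum_add_distrib, ← sum_add_distrib]
      refine sum_congr rfl fun i _ => ?_
      have := congrArg (((i : ℕ) + 1) * ·) (ite_descent_add N σ i)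
      simpa only [mul_add, mul_ite, mul_one, mul_zero] using this
    omega

/-- In the reversed alphabet `(Fin l)ᵒᵈ`, monotone means weakly decreasing in `Fin l`, and
compatible with `σ` means strictly decreasing at the elements of `dexSet σ`. -/
theorem monotone_and_compat_iff {N l : ℕ} (σ : Equiv.Perm (Fin (N + 1)))
    (s : Fin (N + 1) → (Fin l)ᵒᵈ) :
    Monotone s ∧ Compat σ s ↔ ∀ i : Fin N, ((s i.succ).ofDual : ℕ) +
      (if i.castSucc ∈ dexSet σ then 1 else 0) ≤ (s i.castSucc).ofDual := by
  have hdex : ∀ i : Fin N, i.castSucc ∈ dexSet σ ↔ key σ i.succ < key σ i.castSucc := fun i => by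
    simp [dexSet, Fin.succ]
  have hcmp : ∀ i : Fin N, s i.castSucc ≤ s i.succ ↔
      ((s i.succ).ofDual : ℕ) ≤ (s i.castSucc).ofDual := fun i => Iff.rfl
  have hcmp' : ∀ i : Fin N, s i.castSucc < s i.succ ↔
      ((s i.succ).ofDual : ℕ) < (s i.castSucc).ofDual := fun i => Iff.rfl
  constructor
  · rintro ⟨h1, h2⟩ i
    have h3 := (hcmp i).1 (h1 (Fin.castSucc_lt_succ (i := i)).le)
    split_ifs with h4
    · rw [hdex] at h4
      refine Nat.succ_le_of_lt (lt_of_le_of_ne h3 fun h5 => ?_)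
      have : s i.castSucc = s i.succ := OrderDual.ofDual.injective (Fin.ext h5.symm)
      exact lt_asymm h4 (h2 _ _ Fin.castSucc_lt_succ this)
    · exact h3
  · intro h
    have hs : Monotone s := Fin.monotone_iff_le_succ.2 fun i =>
      (hcmp i).2 ((Nat.le_add_right _ _).trans (h i))
    have hlex : StrictMono fun p => toLex (s p, key σ p) := by
      refine Fin.strictMono_iff_lt_succ.2 fun i => ?_
      rw [Prod.Lex.toLex_lt_toLex]
      have hi := h i
      rcases (hs (Fin.castSucc_lt_succ (i := i)).le).lt_or_eq with h1 | h1
      · exact Or.inl h1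
      · refine Or.inr ⟨h1, lt_of_le_of_ne ?_ ?_⟩
        · by_contra hlt
          rw [if_pos ((hdex i).2 (not_le.1 hlt)), h1] at hi
          omega
        · intro he
          have := σ.injective (Prod.mk.inj (toLex.injective he)).2
          simp [Fin.ext_iff] at this
    exact ⟨hs, fun i j hij hsij =>
      ((Prod.Lex.toLex_lt_toLex.1 (hlex hij)).resolve_left fun h' => h'.ne hsij).2⟩

end Dex

/-! ### The specialization `x c = q^c` -/

section Adic

variable {R : Type*} [CommRing R] (q : R)

/-- A truncated geometric series. -/
theorem pow_dvd_sum_pow_sub {e : ℕ} (he : 0 < e) (l b : ℕ) :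
    q ^ l ∣ (1 - q ^ e) * (∑ a ∈ univ.filter (fun a : Fin l => b ≤ (a : ℕ)), q ^ (e * a)) - q ^ (e * b) := by
  have hl : ∀ k, l ≤ k → q ^ l ∣ q ^ (e * k) := fun k hk =>
    pow_dvd_pow q (hk.trans (Nat.le_mul_of_pos_left k he))
  rcases le_or_gt b l with h | h
  · have : (1 - q ^ e) * (∑ a ∈ univ.filter (fun a : Fin l => b ≤ (a : ℕ)), q ^ (e * a)) = q ^ (e * b) - q ^ (e * l) := by
      rw [sum_filter, Fin.sum_univ_eq_sum_range (fun a => if b ≤ a then q ^ (e * a) else 0)]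
      clear hl
      induction l, h using Nat.le_induction with
      | base =>
        rw [sum_eq_zero fun a ha => if_neg (by simpa using ha)]; simp
      | succ l hl ih => rw [sum_range_succ, mul_add, ih, if_pos hl]; ring
    rw [this, sub_sub_cancel_left]
    exact (hl l le_rfl).neg_right
  · rw [filter_false_of_mem fun a _ => by have := a.2; omega, sum_empty, mul_zero, zero_sub]
    exact (hl b h.le).neg_right

/-- Modulo `q^l`, the sum of `q^(s 0 + s 1 + ⋯)` over the sequences in `{0, …, l - 1}` with
`s i ≥ s (i + 1) + δ i` is a product of geometric series. The exponent `e` of `s 0` makes the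
induction, which sums over `s 0` first, go through. -/
theorem pow_dvd_qPoch_mul_sum {N : ℕ} (l : ℕ) (δ : Fin N → ℕ) {e : ℕ} (he : 0 < e) :
    q ^ l ∣ (∏ i ∈ range (N + 1), (1 - q ^ (e + i))) *
      (∑ s : Fin (N + 1) → Fin l with (∀ i : Fin N, (s i.succ : ℕ) + δ i ≤ s i.castSucc),
        q ^ (e * (s 0 : ℕ)) * ∏ i : Fin N, q ^ (s i.succ : ℕ)) -
      q ^ ∑ i : Fin N, (e + i) * δ i := by
  induction N generalizing e with
  | zero =>
    have h := pow_dvd_sum_pow_sub q he l 0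
    have h2 : ∑ s : Fin 1 → Fin l, q ^ (e * (s 0 : ℕ)) = ∑ a : Fin l, q ^ (e * (a : ℕ)) :=
      (Equiv.funUnique (Fin 1) (Fin l)).sum_comp fun a => q ^ (e * (a : ℕ))
    simpa [h2] using h
  | succ N ih =>
    specialize ih (δ ∘ Fin.succ) (Nat.succ_pos e)
    set P := ∏ i ∈ range (N + 1), (1 - q ^ (e + 1 + i)) with hP
    have hprod : ∏ i ∈ range (N + 1 + 1), (1 - q ^ (e + i)) = (1 - q ^ e) * P := by
      rw [prod_range_succ', mul_comm, add_zero]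
      congr 1
      exact prod_congr rfl fun i _ => by rw [add_assoc, add_comm 1 i]
    have hsum : ∑ s : Fin (N + 1 + 1) → Fin l with
          (∀ i : Fin (N + 1), (s i.succ : ℕ) + δ i ≤ s i.castSucc),
          q ^ (e * (s 0 : ℕ)) * ∏ i : Fin (N + 1), q ^ (s i.succ : ℕ) =
        ∑ s : Fin (N + 1) → Fin l with
          (∀ i : Fin N, (s i.succ : ℕ) + (δ ∘ Fin.succ) i ≤ s i.castSucc),
          (∑ a ∈ univ.filter (fun a : Fin l => (s 0 : ℕ) + δ 0 ≤ (a : ℕ)), q ^ (e * (a : ℕ))) *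
            (q ^ (s 0 : ℕ) * ∏ i : Fin N, q ^ (s i.succ : ℕ)) := by
      simp_rw [sum_mul]
      rw [sum_sigma']
      refine sum_nbij' (fun s => ⟨Fin.tail s, s 0⟩) (fun z => (Fin.cons z.2 z.1 : Fin (N + 1 + 1) → Fin l)) ?_ ?_ ?_ ?_ ?_
      · intro s h
        simp only [mem_filter_univ, mem_sigma] at h ⊢
        exact ⟨fun i => h i.succ, h 0⟩
      · rintro ⟨s, a⟩ h
        simp only [mem_filter_univ, mem_sigma] at h ⊢
        exact Fin.forall_fin_succ.2 ⟨h.2, h.1⟩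
      · intro s _; simp
      · rintro ⟨s, a⟩ _; simp
      · intro s _
        rw [Fin.prod_univ_succ]
        rfl
    have hexp : ∑ i : Fin (N + 1), (e + i) * δ i =
        e * δ 0 + ∑ i : Fin N, (e + 1 + i) * (δ ∘ Fin.succ) i := by
      rw [Fin.sum_univ_succ]
      simp only [Fin.val_zero, add_zero, Fin.val_succ, Function.comp_apply]
      congr 1
      exact sum_congr rfl fun i _ => by ring
    set S := ∑ s : Fin (N + 1) → Fin l with
      (∀ i : Fin N, (s i.succ : ℕ) + (δ ∘ Fin.succ) i ≤ s i.castSucc),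
      q ^ ((e + 1) * (s 0 : ℕ)) * ∏ i : Fin N, q ^ (s i.succ : ℕ) with hS
    have hfirst : q ^ l ∣ (1 - q ^ e) * (∑ s : Fin (N + 1) → Fin l with
          (∀ i : Fin N, (s i.succ : ℕ) + (δ ∘ Fin.succ) i ≤ s i.castSucc),
          (∑ a ∈ univ.filter (fun a : Fin l => (s 0 : ℕ) + δ 0 ≤ (a : ℕ)), q ^ (e * (a : ℕ))) *
            (q ^ (s 0 : ℕ) * ∏ i : Fin N, q ^ (s i.succ : ℕ))) - q ^ (e * δ 0) * S := by
      rw [hS, mul_sum, mul_sum, ← sum_sub_distrib]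
      refine dvd_sum fun s _ => ?_
      refine ((pow_dvd_sum_pow_sub q he l (s 0 + δ 0)).mul_right
        (q ^ (s 0 : ℕ) * ∏ i : Fin N, q ^ (s i.succ : ℕ))).trans (dvd_of_eq ?_)
      ring
    rw [hprod, hsum, hexp]
    refine (dvd_add (hfirst.mul_left P) (ih.mul_left (q ^ (e * δ 0)))).trans (dvd_of_eq ?_)
    rw [pow_add]
    ring

theorem qPoch_eq (N : ℕ) : qPoch q N = ∏ i ∈ range N, (1 - q ^ (1 + i)) :=
  prod_congr rfl fun i _ => by rw [add_comm]

theorem pow_dvd_qPoch_mul_monoSum (n l : ℕ) :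
    q ^ l ∣ qPoch q n * monoSum n (fun c : (Fin l)ᵒᵈ => q ^ (c.ofDual : ℕ)) - 1 := by
  classical
  cases n with
  | zero => simp [qPoch, monoSum, Subsingleton.monotone]
  | succ N =>
    have h := pow_dvd_qPoch_mul_sum q l (fun _ : Fin N => 0) one_pos
    rw [← qPoch_eq] at h
    simp only [mul_zero, sum_const_zero, pow_zero] at h
    convert h using 3
    refine sum_nbij' (fun s p => (s p).ofDual) (fun s p => OrderDual.toDual (s p)) ?_ ?_ ?_ ?_ ?_
    · intro s hs
      rw [mem_filter_univ] at hs ⊢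
      exact fun i => hs (Fin.castSucc_lt_succ (i := i)).le
    · intro s hs
      rw [mem_filter_univ] at hs ⊢
      exact Fin.monotone_iff_le_succ.2 hs
    · intro s _; rfl
    · intro s _; rfl
    · intro s _
      rw [Fin.prod_univ_succ, one_mul]

theorem pow_dvd_qPoch_mul_compatSum (n l : ℕ) (t r : R) :
    q ^ l ∣ qPoch q n * compatSum n t r (fun c : (Fin l)ᵒᵈ => q ^ (c.ofDual : ℕ)) -
      ∑ σ : Equiv.Perm (Fin n), q ^ dexSum σ * t ^ exc σ * r ^ fix σ := by
  classical
  have hswap : compatSum n t r (fun c : (Fin l)ᵒᵈ => q ^ (c.ofDual : ℕ)) =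
      ∑ σ : Equiv.Perm (Fin n), (∑ s : Fin n → (Fin l)ᵒᵈ with Monotone s ∧ Compat σ s,
        ∏ p, q ^ ((s p).ofDual : ℕ)) * (t ^ exc σ * r ^ fix σ) := by
    simp only [compatSum, mul_sum, sum_mul]
    refine sum_comm' fun s σ => ?_
    simp only [mem_filter, mem_univ, true_and, and_true]
  rw [hswap, mul_sum, ← sum_sub_distrib]
  refine dvd_sum fun σ _ => ?_
  suffices h : q ^ l ∣ qPoch q n * (∑ s : Fin n → (Fin l)ᵒᵈ with Monotone s ∧ Compat σ s,
      ∏ p, q ^ ((s p).ofDual : ℕ)) - q ^ dexSum σ from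
    (h.mul_right (t ^ exc σ * r ^ fix σ)).trans (dvd_of_eq (by ring))
  cases n with
  | zero => simp [qPoch, dexSum, dexSet, Subsingleton.monotone, Compat]
  | succ N =>
    have h := pow_dvd_qPoch_mul_sum q l
      (fun i : Fin N => if i.castSucc ∈ dexSet σ then 1 else 0) one_pos
    rw [← qPoch_eq] at h
    convert h using 3
    · refine sum_nbij' (fun s p => (s p).ofDual) (fun s p => OrderDual.toDual (s p)) ?_ ?_ ?_ ?_ ?_
      · intro s hs
        rw [mem_filter_univ] at hs ⊢
        exact (monotone_and_compat_iff σ s).1 hs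
      · intro s hs
        rw [mem_filter_univ] at hs ⊢
        exact (monotone_and_compat_iff σ _).2 hs
      · intro s _; rfl
      · intro s _; rfl
      · intro s _
        rw [Fin.prod_univ_succ, one_mul]
    · have h1 : dexSum σ = ∑ i : Fin N, if key σ i.succ < key σ i.castSucc then ((i : ℕ) + 1) else 0 :=
        sum_filter_succ_lt (fun a b => key σ a < key σ b) _
      rw [h1]
      refine sum_congr rfl fun i _ => ?_
      simp [dexSet, Fin.succ, add_comm]

end Adic

/-- The generating polynomial of `(maj - exc, exc, fix)` on `S_n`. -/
def dexPoly {R : Type*} [CommSemiring R] (n : ℕ) (q t r : R) : R :=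
  ∑ σ : Equiv.Perm (Fin n), q ^ dexSum σ * t ^ exc σ * r ^ fix σ

theorem pow_dvd_sum_gaussBinom_mul_dexPoly {R : Type*} [CommRing R] [IsDomain R] (n l : ℕ)
    (q t r : R) :
    q ^ l ∣ ∑ p ∈ antidiagonal n, (t ^ p.1 - t) * (gaussBinom q n p.1 * dexPoly p.2 q t r) -
      (1 - t) * r ^ n := by
  set x : (Fin l)ᵒᵈ → R := fun c => q ^ (c.ofDual : ℕ) with hx
  have h3 : (1 - t) * r ^ n * (qPoch q n * monoSum n x) = ∑ p ∈ antidiagonal n,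
      (t ^ p.1 - t) * gaussBinom q n p.1 *
        ((qPoch q p.1 * monoSum p.1 x) * (qPoch q p.2 * compatSum p.2 t r x)) := by
    rw [show (1 - t) * r ^ n * (qPoch q n * monoSum n x) =
      qPoch q n * ((1 - t) * r ^ n * monoSum n x) by ring, ← sum_monoSum_mul_compatSum, mul_sum]
    refine sum_congr rfl fun p hp => ?_
    rw [HasAntidiagonal.mem_antidiagonal] at hp
    rw [← hp, ← gaussBinom_add_mul]
    ring
  have h2 : ∑ p ∈ antidiagonal n, (t ^ p.1 - t) * (gaussBinom q n p.1 * dexPoly p.2 q t r) -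
      (1 - t) * r ^ n =
      (1 - t) * r ^ n * (qPoch q n * monoSum n x - 1) -
      ∑ p ∈ antidiagonal n, (t ^ p.1 - t) * gaussBinom q n p.1 *
        ((qPoch q p.1 * monoSum p.1 x - 1) * (qPoch q p.2 * compatSum p.2 t r x) +
        (qPoch q p.2 * compatSum p.2 t r x - dexPoly p.2 q t r)) := by
    rw [mul_sub, h3, mul_one, sub_right_comm, ← sum_sub_distrib]
    congr 1
    refine sum_congr rfl fun p _ => ?_
    ring
  rw [h2]
  refine dvd_sub ((pow_dvd_qPoch_mul_monoSum q n l).mul_left _) (dvd_sum fun p _ => ?_)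
  exact (dvd_add ((pow_dvd_qPoch_mul_monoSum q p.1 l).mul_right _)
    (pow_dvd_qPoch_mul_compatSum q p.2 l t r)).mul_left _

/-- The `q`-binomial recurrence for the joint distribution of `maj - exc`, `exc` and `fix`. -/
theorem sum_gaussBinom_mul_dexPoly {R : Type*} [CommRing R] [IsDomain R] (n : ℕ) (q t r : R) :
    ∑ p ∈ antidiagonal n, (t ^ p.1 - t) * (gaussBinom q n p.1 * dexPoly p.2 q t r) =
      (1 - t) * r ^ n := by
  -- With the indeterminate `X` in place of `q`, the two sides agree modulo every power of `X`.
  have key : ∑ p ∈ antidiagonal n, (Polynomial.C t ^ p.1 - Polynomial.C t) *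
      (gaussBinom Polynomial.X n p.1 * dexPoly p.2 Polynomial.X (Polynomial.C t) (Polynomial.C r)) -
      (1 - Polynomial.C t) * Polynomial.C r ^ n = 0 := by
    ext k
    exact Polynomial.X_pow_dvd_iff.1
      (pow_dvd_sum_gaussBinom_mul_dexPoly n (k + 1) _ _ _) k k.lt_succ_self
  have := congrArg (Polynomial.evalRingHom q) key
  have heval : ∀ i, Polynomial.eval q (gaussBinom Polynomial.X n i) = gaussBinom q n i := fun i => by
    simpa using map_gaussBinom (Polynomial.X : Polynomial R) (Polynomial.evalRingHom q) n i
  simpa [heval, dexPoly, sub_eq_zero, Polynomial.eval_finsetSum] using this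

/-! ### The recurrence at a root of unity -/

section RootOfUnity

variable {R : Type*} [CommRing R]

theorem one_add_mul_qNum {d : ℕ} (hd : 0 < d) (t : R) : 1 + t * qNum (d - 1) t = qNum d t := by
  obtain ⟨e, rfl⟩ := Nat.exists_eq_succ_of_ne_zero hd.ne'
  simp only [qNum, Nat.succ_eq_add_one, Nat.add_sub_cancel]
  rw [sum_range_succ', mul_sum, add_comm]
  simp [pow_succ']

theorem pow_add_mul_qNum {d : ℕ} (hd : 0 < d) (t : R) :
    t ^ d + t * qNum (d - 1) t = t * qNum d t := by
  obtain ⟨e, rfl⟩ := Nat.exists_eq_succ_of_ne_zero hd.ne'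
  simp only [qNum, Nat.succ_eq_add_one, Nat.add_sub_cancel]
  rw [sum_range_succ]
  ring

theorem dexPoly_one (n : ℕ) (t r : R) : dexPoly n 1 t r = excFixPoly n t r := by
  simp [dexPoly, excFixPoly]

theorem majExcFixPoly_eq_dexPoly (n : ℕ) {q q' : R} (h : q * q' = 1) (t r : R) :
    majExcFixPoly n q (t * q') r = dexPoly n q t r := by
  refine sum_congr rfl fun σ _ => ?_
  rw [maj_eq_dexSum_add_exc, mul_pow, pow_add]
  linear_combination (q ^ dexSum σ * t ^ exc σ * r ^ fix σ) * (by rw [← mul_pow, h, one_pow] :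
    q ^ exc σ * q' ^ exc σ = 1)

theorem sum_choose_mul_excFixPoly [IsDomain R] (k : ℕ) (t r : R) :
    ∑ p ∈ antidiagonal k, (t ^ p.1 - t) * (k.choose p.1 * excFixPoly p.2 t r) =
      (1 - t) * r ^ k := by
  simpa only [gaussBinom_one, dexPoly_one] using sum_gaussBinom_mul_dexPoly k 1 t r

theorem sum_choose_mul_dexPoly_primitiveRoot [IsDomain R] {d : ℕ} (hd : 0 < d) {q : R}
    (hq : IsPrimitiveRoot q d) (k : ℕ) (t r : R) :
    ∑ p ∈ antidiagonal k, ((t ^ d) ^ p.1 - t) * (k.choose p.1 * dexPoly (d * p.2) q t r) =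
      (1 - t) * (r ^ d) ^ k := by
  rw [← pow_mul, ← sum_gaussBinom_mul_dexPoly (d * k) q t r]
  refine sum_of_injOn (fun p => (d * p.1, d * p.2)) ?_ ?_ ?_ ?_
  · intro p _ p' _ h
    obtain ⟨h1, h2⟩ := Prod.mk.inj h
    exact Prod.ext (Nat.eq_of_mul_eq_mul_left hd h1) (Nat.eq_of_mul_eq_mul_left hd h2)
  · intro p hp
    simp only [mem_coe, HasAntidiagonal.mem_antidiagonal] at hp ⊢
    rw [← mul_add, hp]
  · intro p hp hp'
    rw [gaussBinom_mul_primitiveRoot hq hd, if_neg, zero_mul, mul_zero]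
    rintro ⟨i, hi⟩
    rw [HasAntidiagonal.mem_antidiagonal] at hp
    obtain ⟨j, hj⟩ : d ∣ p.2 := (Nat.dvd_add_right ⟨i, hi⟩).1 ⟨k, hp⟩
    refine hp' ⟨(i, j), ?_, Prod.ext hi.symm hj.symm⟩
    rw [mem_coe, HasAntidiagonal.mem_antidiagonal]
    refine Nat.eq_of_mul_eq_mul_left hd ?_
    rw [mul_add, ← hi, ← hj, hp]
  · intro p _
    rw [gaussBinom_mul_primitiveRoot hq hd, if_pos ⟨_, rfl⟩, Nat.mul_div_cancel_left _ hd, pow_mul]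

variable {K : Type*} [Field K] [CharZero K]

/-- A binomial recurrence, as an equation between exponential generating functions. -/
theorem egf_mul_eq {b : ℕ → K} {t u v w : K}
    (h : ∀ k, ∑ p ∈ antidiagonal k, (u ^ p.1 - t * w ^ p.1) * (k.choose p.1 * b p.2) =
      (1 - t) * v ^ k) :
    (PowerSeries.rescale u (PowerSeries.exp K) -
        PowerSeries.C t * PowerSeries.rescale w (PowerSeries.exp K)) *
      PowerSeries.mk (fun k => b k / k.factorial) =
      PowerSeries.C (1 - t) * PowerSeries.rescale v (PowerSeries.exp K) := by
  ext k
  rw [PowerSeries.coeff_C_mul, PowerSeries.coeff_mul]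
  simp only [PowerSeries.coeff_C_mul, map_sub, PowerSeries.coeff_rescale, PowerSeries.coeff_mk,
    PowerSeries.coeff_exp, map_div₀, map_one, map_natCast]
  rw [mul_one_div, ← mul_div_assoc, ← h, sum_div]
  refine sum_congr rfl fun p hp => ?_
  rw [HasAntidiagonal.mem_antidiagonal] at hp
  have h1 : (p.1.factorial : K) ≠ 0 := Nat.cast_ne_zero.2 (Nat.factorial_ne_zero _)
  have h2 : (p.2.factorial : K) ≠ 0 := Nat.cast_ne_zero.2 (Nat.factorial_ne_zero _)
  have h3 : (k.factorial : K) ≠ 0 := Nat.cast_ne_zero.2 (Nat.factorial_ne_zero _)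
  have h4 : (k.choose p.1 : K) * p.1.factorial * p.2.factorial = k.factorial := by
    rw [← hp]
    rw [Nat.choose_symm_add]
    exact_mod_cast Nat.add_choose_mul_factorial_mul_factorial p.1 p.2
  field_simp
  rw [← h4]
  ring

/-- At a primitive `d`-th root of unity `q`, the recurrence for `dexPoly (d * k) q t s` is an
ordinary binomial one. Its exponential generating function is that of `excFixPoly k t r`, rescaled
by `[d]_t`, because `t [d]_t = t^d + t [d-1]_t` and `[d]_t = 1 + t [d-1]_t`. -/
theorem dexPoly_primitiveRoot {d : ℕ} (hd : 0 < d) {q : K} (hq : IsPrimitiveRoot q d) (k : ℕ)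
    {t : K} (ht : t ≠ 1) (htd : qNum d t ≠ 0) (s : K) :
    dexPoly (d * k) q t s =
      excFixPoly k t ((s ^ d + t * qNum (d - 1) t) / qNum d t) * qNum d t ^ k := by
  set δ := qNum d t with hδ
  set r := (s ^ d + t * qNum (d - 1) t) / δ with hr
  set c := t * qNum (d - 1) t with hc
  have hb := egf_mul_eq (K := K) (b := fun k => dexPoly (d * k) q t s) (t := t) (u := t ^ d)
    (w := 1) (v := s ^ d) fun k => by
      simpa using sum_choose_mul_dexPoly_primitiveRoot hd hq k t s
  have ha := egf_mul_eq (K := K) (b := fun k => excFixPoly k t r * δ ^ k) (t := t) (u := t * δ)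
    (w := δ) (v := r * δ) fun k => by
      rw [mul_pow r, ← mul_assoc (1 - t), ← sum_choose_mul_excFixPoly, sum_mul]
      refine sum_congr rfl fun p hp => ?_
      rw [HasAntidiagonal.mem_antidiagonal] at hp
      rw [← hp, mul_pow, pow_add]
      ring
  have e1 : r * δ = s ^ d + c := div_mul_cancel₀ _ htd
  have e2 : t * δ = t ^ d + c := (pow_add_mul_qNum hd t).symm
  have e3 : PowerSeries.rescale δ (PowerSeries.exp K) = PowerSeries.rescale (1 + c) (PowerSeries.exp K) := by
    rw [hc, one_add_mul_qNum hd]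
  rw [e1, e2, e3, ← PowerSeries.exp_mul_exp_eq_exp_add, ← PowerSeries.exp_mul_exp_eq_exp_add,
    ← PowerSeries.exp_mul_exp_eq_exp_add, ← mul_assoc, ← mul_assoc, ← hb, ← sub_mul,
    mul_right_comm] at ha
  have hexp : PowerSeries.rescale c (PowerSeries.exp K) ≠ 0 := fun h => by
    have := congrArg (PowerSeries.coeff 0) h
    rw [PowerSeries.coeff_rescale] at this
    simp at this
  have hden : PowerSeries.rescale (t ^ d) (PowerSeries.exp K) -
      PowerSeries.C t * PowerSeries.rescale 1 (PowerSeries.exp K) ≠ 0 := fun h => by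
    have := congrArg (PowerSeries.coeff 0) h
    simp only [map_sub, PowerSeries.coeff_C_mul, PowerSeries.coeff_rescale] at this
    simp [sub_eq_zero] at this
    exact ht this.symm
  have := mul_left_cancel₀ hden (mul_right_cancel₀ hexp ha)
  have hk := congrArg (PowerSeries.coeff k) this
  simp only [PowerSeries.coeff_mk] at hk
  exact ((div_left_inj' (Nat.cast_ne_zero.2 (Nat.factorial_ne_zero k))).1 hk).symm

end RootOfUnity

/-! ### The centralizer of a power of the long cycle -/

section Centralizer

variable {d k : ℕ}

theorem val_finRotate_pow_apply {n : ℕ} (m : ℕ) (i : Fin n) :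
    (((finRotate n ^ m) i : Fin n) : ℕ) = (i + m) % n := by
  induction m with
  | zero => simp [Nat.mod_eq_of_lt i.2]
  | succ m ih =>
    have := i.neZero
    rw [pow_succ', Equiv.Perm.mul_apply, finRotate_apply, Fin.val_add, ih, Fin.val_one']
    simp [add_assoc]

variable [NeZero d]

/-- In the coordinates `(j, a) ↦ a + k j`, the `k`-th power of the long cycle shifts `j`. -/
theorem finRotate_pow_finProdFinEquiv (j : Fin d) (a : Fin k) :
    (finRotate (d * k) ^ k) (finProdFinEquiv (j, a)) = finProdFinEquiv (j + 1, a) := by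
  ext
  rw [val_finRotate_pow_apply]
  simp only [finProdFinEquiv_apply_val, Fin.val_add, Fin.val_one', Nat.add_mod_mod]
  have hj := j.2
  rcases (Nat.succ_le_of_lt hj).lt_or_eq with h | h
  · rw [Nat.mod_eq_of_lt (a := (j : ℕ) + 1) h, Nat.mod_eq_of_lt]
    · ring
    · calc (a : ℕ) + k * j + k = a + k * (j + 1) := by ring
        _ < k + k * (j + 1) := by have := a.2; omega
        _ = k * (j + 1 + 1) := by ring
        _ ≤ k * d := Nat.mul_le_mul_left k h
        _ = d * k := mul_comm _ _
  · rw [Nat.succ_eq_add_one] at h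
    rw [h, Nat.mod_self, mul_zero, add_zero, add_assoc, ← Nat.mul_succ, Nat.succ_eq_add_one, h,
      mul_comm k d, Nat.add_mod_right, Nat.mod_eq_of_lt]
    calc (a : ℕ) < k := a.2
      _ ≤ d * k := Nat.le_mul_of_pos_left k (NeZero.pos d)

/-- The permutation `(j, a) ↦ (j + c a, π a)` of `Fin d × Fin k`. -/
def wreathPerm (x : Equiv.Perm (Fin k) × (Fin k → Fin d)) : Equiv.Perm (Fin d × Fin k) where
  toFun y := (y.1 + x.2 y.2, x.1 y.2)
  invFun y := (y.1 - x.2 (x.1.symm y.2), x.1.symm y.2)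
  left_inv y := by simp
  right_inv y := by simp

theorem wreathPerm_injective :
    Function.Injective (wreathPerm : Equiv.Perm (Fin k) × (Fin k → Fin d) → _) := by
  rintro ⟨π, c⟩ ⟨π', c'⟩ h
  have h' : ∀ a, c a = c' a ∧ π a = π' a := fun a => by
    simpa [wreathPerm] using congrArg (fun e : Equiv.Perm (Fin d × Fin k) => e (0, a)) h
  exact Prod.ext (Equiv.ext fun a => (h' a).2) (funext fun a => (h' a).1)

/-- The permutations commuting with the shift of the first coordinate are the `wreathPerm`s. -/
theorem exists_wreathPerm_eq {τ : Equiv.Perm (Fin d × Fin k)}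
    (hτ : ∀ j a, τ (j + 1, a) = ((τ (j, a)).1 + 1, (τ (j, a)).2)) : ∃ x, wreathPerm x = τ := by
  have hval : ∀ (m : ℕ) (hm : m < d) (a : Fin k),
      τ (⟨m, hm⟩, a) = (⟨m, hm⟩ + (τ (0, a)).1, (τ (0, a)).2) := by
    intro m
    induction m with
    | zero => intro _ a; exact Prod.ext (zero_add _).symm rfl
    | succ m ih =>
      intro hm a
      have h1 : (⟨m + 1, hm⟩ : Fin d) = ⟨m, by omega⟩ + 1 := by
        ext
        simp [Fin.val_add, Nat.mod_eq_of_lt hm]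
      rw [h1, hτ, ih]
      exact Prod.ext (add_right_comm _ _ _) rfl
  have hall : ∀ (j : Fin d) (a : Fin k), τ (j, a) = (j + (τ (0, a)).1, (τ (0, a)).2) :=
    fun j a => hval j j.2 a
  have hinj : Function.Injective fun a => (τ (0, a)).2 := by
    intro a a' h
    have h1 : τ ((τ (0, a')).1 - (τ (0, a)).1, a) = τ (0, a') := by
      rw [hall]
      exact Prod.ext (sub_add_cancel _ _) h
    exact (Prod.mk.inj (τ.injective h1)).2
  exact ⟨(Equiv.ofBijective _ (Finite.injective_iff_bijective.1 hinj), fun a => (τ (0, a)).1),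
    Equiv.ext fun y => (hall y.1 y.2).symm⟩

theorem mem_centralizer_iff (τ : Equiv.Perm (Fin d × Fin k)) :
    finProdFinEquiv.permCongr τ ∈ Subgroup.centralizer {finRotate (d * k) ^ k} ↔
      ∀ j a, τ (j + 1, a) = ((τ (j, a)).1 + 1, (τ (j, a)).2) := by
  rw [Subgroup.mem_centralizer_singleton_iff, Equiv.ext_iff, ← finProdFinEquiv.forall_congr_right,
    Prod.forall]
  refine forall_congr' fun j => forall_congr' fun a => ?_
  rw [Equiv.Perm.mul_apply, Equiv.Perm.mul_apply, finRotate_pow_finProdFinEquiv,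
    Equiv.permCongr_apply, Equiv.permCongr_apply, Equiv.symm_apply_apply, Equiv.symm_apply_apply,
    ← Prod.mk.eta (p := τ (j, a)), finRotate_pow_finProdFinEquiv, finProdFinEquiv.injective.eq_iff]

omit [NeZero d] in
theorem finProdFinEquiv_lt_iff (x y : Fin d × Fin k) :
    finProdFinEquiv x < finProdFinEquiv y ↔ x.1 < y.1 ∨ x.1 = y.1 ∧ x.2 < y.2 := by
  have hx := x.2.2
  have hy := y.2.2
  simp only [Fin.lt_def, finProdFinEquiv_apply_val, Fin.ext_iff]
  rcases lt_trichotomy (x.1 : ℕ) y.1 with h | h | h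
  · have := Nat.mul_le_mul_left k (Nat.succ_le_of_lt h)
    rw [Nat.mul_succ] at this
    constructor
    · intro _; exact Or.inl h
    · intro _; omega
  · simp [h]
  · have := Nat.mul_le_mul_left k (Nat.succ_le_of_lt h)
    rw [Nat.mul_succ] at this
    constructor
    · intro _; omega
    · intro _; omega

variable {R : Type*} [CommRing R]

theorem pow_exc_mul_pow_fix {n : ℕ} (σ : Equiv.Perm (Fin n)) (t s : R) :
    t ^ exc σ * s ^ fix σ =
      ∏ i, ((if i < σ i then t else 1) * if σ i = i then s else 1) := by
  rw [prod_mul_distrib, prod_ite, prod_ite, prod_const_one, prod_const_one, mul_one, mul_one,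
    prod_const, prod_const, exc, excSet, fix]

theorem card_lt_add {c : Fin d} (hc : c ≠ 0) :
    (univ.filter fun j : Fin d => j < j + c).card = d - c := by
  have h : ∀ j : Fin d, j < j + c ↔ (j : ℕ) < d - c := by
    intro j
    have hj := j.2
    have hc' : (c : ℕ) ≠ 0 := fun h => hc (Fin.ext h)
    rw [Fin.lt_def, Fin.val_add_eq_ite]
    split_ifs <;> omega
  rw [filter_congr fun j _ => h j, Fin.card_filter_val_lt]
  omega

/-- The total weight of the `d` shifts in a column sent to a column to the right, to itself, or to
the left. -/
theorem sum_shift_weight (t s : R) (a b : Fin k) :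
    ∑ c : Fin d, ∏ j : Fin d, ((if j < j + c ∨ j = j + c ∧ a < b then t else 1) *
        if j + c = j ∧ b = a then s else 1) =
      (if a < b then t ^ d else 1) * (if b = a then s ^ d else 1) + t * qNum (d - 1) t := by
  obtain ⟨e, rfl⟩ := Nat.exists_eq_succ_of_ne_zero (NeZero.ne d)
  rw [Fin.sum_univ_succ]
  congr 1
  · simp only [add_zero, lt_irrefl, true_and, false_or, prod_const, card_univ, Fintype.card_fin,
      mul_pow, ite_pow, one_pow]
  · rw [Nat.succ_sub_one, qNum, mul_sum, ← sum_range_reflect,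
      ← Fin.sum_univ_eq_sum_range (fun j => t * t ^ (e - 1 - j))]
    refine sum_congr rfl fun c _ => ?_
    have h1 : ∀ j : Fin (e + 1), j + c.succ ≠ j := fun j h => Fin.succ_ne_zero c (add_eq_left.1 h)
    have h2 : ∀ j : Fin (e + 1), j ≠ j + c.succ := fun j => (h1 j).symm
    simp only [h1, h2, false_and, or_false, if_false, mul_one]
    rw [prod_ite, prod_const_one, mul_one, prod_const, card_lt_add (Fin.succ_ne_zero c), ← pow_succ']
    congr 1
    have := c.2
    simp only [Fin.val_succ]
    omega

/-- The elements of the centralizer are given by a permutation `π` of the columns and a shift of each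
column, and their weights multiply over the columns. -/
theorem centralizerExcFixPoly_eq (t s : R) :
    centralizerExcFixPoly (finRotate (d * k) ^ k) t s =
      ∑ π : Equiv.Perm (Fin k), ∏ a, ((if a < π a then t ^ d else 1) *
        (if π a = a then s ^ d else 1) + t * qNum (d - 1) t) := by
  classical
  have h1 : centralizerExcFixPoly (finRotate (d * k) ^ k) t s =
      ∑ x : Equiv.Perm (Fin k) × (Fin k → Fin d),
        t ^ exc (finProdFinEquiv.permCongr (wreathPerm x)) *
          s ^ fix (finProdFinEquiv.permCongr (wreathPerm x)) := by
    symm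
    refine sum_bij (fun x _ => finProdFinEquiv.permCongr (wreathPerm x)) ?_ ?_ ?_ (fun _ _ => rfl)
    · intro x _
      rw [mem_filter_univ, mem_centralizer_iff]
      intro j a
      exact Prod.ext (add_right_comm _ _ _) rfl
    · intro x _ y _ h
      exact wreathPerm_injective (finProdFinEquiv.permCongr.injective h)
    · intro σ hσ
      obtain ⟨τ, rfl⟩ := finProdFinEquiv.permCongr.surjective σ
      rw [mem_filter_univ, mem_centralizer_iff] at hσ
      obtain ⟨x, hx⟩ := exists_wreathPerm_eq hσ
      exact ⟨x, mem_univ _, by rw [hx]⟩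
  rw [h1, Fintype.sum_prod_type]
  refine sum_congr rfl fun π _ => ?_
  simp_rw [← sum_shift_weight]
  rw [prod_univ_sum, Fintype.piFinset_univ]
  refine sum_congr rfl fun c _ => ?_
  rw [pow_exc_mul_pow_fix, ← finProdFinEquiv.prod_comp, Fintype.prod_prod_type_right]
  refine prod_congr rfl fun a _ => prod_congr rfl fun j _ => ?_
  rw [Equiv.permCongr_apply, Equiv.symm_apply_apply]
  simp only [finProdFinEquiv_lt_iff, finProdFinEquiv.injective.eq_iff, Prod.ext_iff]
  rfl

theorem centralizerExcFixPoly_eq_excFixPoly {K : Type*} [Field K] {t : K} (ht : qNum d t ≠ 0)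
    (s : K) :
    centralizerExcFixPoly (finRotate (d * k) ^ k) t s =
      excFixPoly k t ((s ^ d + t * qNum (d - 1) t) / qNum d t) * qNum d t ^ k := by
  rw [centralizerExcFixPoly_eq, excFixPoly, sum_mul]
  refine sum_congr rfl fun π _ => ?_
  have hpow : qNum d t ^ k = ∏ _a : Fin k, qNum d t := by simp
  rw [pow_exc_mul_pow_fix, hpow, ← prod_mul_distrib]
  refine prod_congr rfl fun a _ => ?_
  rcases lt_trichotomy a (π a) with h | h | h
  · rw [if_pos h, if_pos h, if_neg h.ne', if_neg h.ne', mul_one, mul_one,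
      pow_add_mul_qNum (NeZero.pos d)]
  · rw [if_neg h.not_lt, if_neg h.not_lt, if_pos h.symm, if_pos h.symm, one_mul, one_mul,
      div_mul_cancel₀ _ ht]
  · rw [if_neg h.not_gt, if_neg h.not_gt, if_neg h.ne, if_neg h.ne, one_mul, one_mul,
      one_add_mul_qNum (NeZero.pos d)]

end Centralizer

end EulerianCyclic

theorem theorem6p1 (n d k : ℕ) (hd : 0 < d) (hn : d * k = n) (ω : ℂ) (hω : IsPrimitiveRoot ω d) :
    EulerianCyclic.majExcFixPoly n (MvPolynomial.C ω : EulerianCyclic.PolyTS)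
        (EulerianCyclic.tVar * MvPolynomial.C ω⁻¹) EulerianCyclic.sVar
      = EulerianCyclic.centralizerExcFixPoly (finRotate n ^ k)
          EulerianCyclic.tVar EulerianCyclic.sVar ∧
    algebraMap EulerianCyclic.PolyTS EulerianCyclic.RatTS
        (EulerianCyclic.centralizerExcFixPoly (finRotate n ^ k)
          EulerianCyclic.tVar EulerianCyclic.sVar)
      = EulerianCyclic.excFixPoly k EulerianCyclic.tRat
          ((EulerianCyclic.sRat ^ d
              + EulerianCyclic.tRat * EulerianCyclic.qNum (d - 1) EulerianCyclic.tRat)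
            / EulerianCyclic.qNum d EulerianCyclic.tRat)
        * EulerianCyclic.qNum d EulerianCyclic.tRat ^ k := by
  open EulerianCyclic in
  subst hn
  have : NeZero d := ⟨hd.ne'⟩
  have : CharZero RatTS :=
    charZero_of_injective_algebraMap (IsFractionRing.injective PolyTS RatTS)
  have hinj := IsFractionRing.injective PolyTS RatTS
  have ht : tRat ≠ 1 := fun h => by
    have h1 : tVar = 1 := hinj (by rw [map_one]; exact h)
    have := congrArg (MvPolynomial.eval fun _ => (0 : ℂ)) h1
    simp [tVar] at this
  have htd : qNum d tRat ≠ 0 := fun h => by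
    have h1 : qNum d tVar = 0 := hinj (by rw [map_zero, ← h]; simp [qNum, tRat])
    -- At `t = 1` the value of `[d]_t` is `d`.
    have := congrArg (MvPolynomial.eval fun _ => (1 : ℂ)) h1
    simp [tVar, qNum, hd.ne'] at this
  have hcent : algebraMap PolyTS RatTS (centralizerExcFixPoly (finRotate (d * k) ^ k) tVar sVar) =
      centralizerExcFixPoly (finRotate (d * k) ^ k) tRat sRat := by
    simp [centralizerExcFixPoly, tRat, sRat]
  have hroot : IsPrimitiveRoot (algebraMap PolyTS RatTS (MvPolynomial.C ω)) d :=
    (hω.map_of_injective (MvPolynomial.C_injective _ _)).map_of_injective hinj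
  refine ⟨hinj ?_, by rw [hcent, centralizerExcFixPoly_eq_excFixPoly htd]⟩
  have hω1 : (MvPolynomial.C ω : PolyTS) * MvPolynomial.C ω⁻¹ = 1 := by
    rw [← MvPolynomial.C_mul, mul_inv_cancel₀ (hω.ne_zero hd.ne'), MvPolynomial.C_1]
  rw [majExcFixPoly_eq_dexPoly _ hω1, hcent, centralizerExcFixPoly_eq_excFixPoly htd,
    ← dexPoly_primitiveRoot hd hroot k ht htd]
  simp [dexPoly, tRat, sRat]
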